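/- Let $\mathrm{Br}_n=\langle\sigma_1,\dots,\sigma_{n-1}\mid \sigma_i\sigma_{i+1}\sigma_i=\sigma_{i+1}\sigma_i\sigma_{i+1},\ \sigma_i\sigma_j=\sigma_j\sigma_i\ (|i-j|\ge 2)\rangle$ be the braid group on $n$ strands. For any group $G$ it acts on $G^n$ from the left by the Hurwitz action $$\sigma_i(g_1,\dots,g_n)=(g_1,\dots,g_{i-1},\,g_ig_{i+1}g_i^{-1},\,g_i,\,g_{i+2},\dots,g_n).$$ Let $C=\langle s,t\mid s^2=t^2=(st)^3=1\rangle\cong\mathcal S_3$, let $\mathcal C_n=(s,t,s,t,\dots)\in C^n$ be the alternating Coxeter system of length $n$, and let $S_{\mathcal C_n}\le\mathrm{Br}_n$ be its stabiliser under the Hurwitz action. Put $m_{ij}=3$ if $i\not\equiv j \bmod 2$ and $m_{ij}=1$ if $i\equiv j\bmod 2$, and let $$E_n=\bigl\langle\, e_{ij}=\sigma_{j-1}\cdots\sigma_{i+1}\,\sigma_i^{m_{ij}}\,\sigma_{i+1}^{-1}\cdots\sigma_{j-1}^{-1}\ \bigm|\ 1\le i<j\le n\,\bigr\rangle\le\mathrm{Br}_n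 .$$ Write $(\sigma)\beta=\beta^{-1}\sigma\beta$, and set $\tau_1=(\sigma_1)\sigma_2\sigma_3^{-1}\sigma_4$ (in $\mathrm{Br}_5$ and in $\mathrm{Br}_6$) and $\tau_2=(\sigma_2)\sigma_3\sigma_4^{-1}\sigma_5$ (in $\mathrm{Br}_6$). Then: 1. $S_{\mathcal C_5}$ is the (internal) semidirect product of its normal subgroup $E_5$ and a free subgroup that is freely generated by $\tau_1$. 2. $S_{\mathcal C_6}$ is the (internal) semidirect product of its normal subgroup $E_6$ and a free subgroup that is freely generated by $\tau_1,\tau_2$. -/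

import Mathlib

namespace HurwitzBraid

/-- The braid relations among the standard generators `σ₁, …, σₙ₋₁` of the braid group on `n`
strands. The letter `i : Fin (n - 1)` stands for `σ_{i+1}`. -/
def braidRels (n : ℕ) : Set (FreeGroup (Fin (n - 1))) :=
  {r | ∃ i j : Fin (n - 1), (i : ℕ) + 1 = j ∧
      r = FreeGroup.of i * FreeGroup.of j * FreeGroup.of i *
        (FreeGroup.of j * FreeGroup.of i * FreeGroup.of j)⁻¹} ∪
  {r | ∃ i j : Fin (n - 1), (i : ℕ) + 2 ≤ j ∧
      r = FreeGroup.of i * FreeGroup.of j * (FreeGroup.of j * FreeGroup.of i)⁻¹}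

/-- The braid group `Brₙ` on `n` strands, by Artin's presentation. -/
abbrev BraidGroup (n : ℕ) : Type := PresentedGroup (braidRels n)

/-- The standard generator `σᵢ` of `Brₙ`, for `1 ≤ i ≤ n - 1` (and `1` for other indices, which
do not occur below). -/
def sigma (n i : ℕ) : BraidGroup n :=
  if h : 1 ≤ i ∧ i < n then PresentedGroup.of ⟨i - 1, by omega⟩ else 1

section Hurwitz

variable {G : Type*} [Group G] {n : ℕ}

/-- The Hurwitz move at the positions `i`, `j` of a tuple: `(gᵢ, gⱼ) ↦ (gᵢ gⱼ gᵢ⁻¹, gᵢ)`. -/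
def hurwitzMove (i j : Fin n) (g : Fin n → G) : Fin n → G :=
  fun k => if k = i then g i * g j * (g i)⁻¹ else if k = j then g i else g k

/-- The inverse move `(gᵢ, gⱼ) ↦ (gⱼ, gⱼ⁻¹ gᵢ gⱼ)`. -/
def hurwitzMoveInv (i j : Fin n) (g : Fin n → G) : Fin n → G :=
  fun k => if k = i then g j else if k = j then (g j)⁻¹ * g i * g j else g k

/-- The Hurwitz move at two distinct positions, as a permutation of `Gⁿ`. -/
def hurwitzPerm (i j : Fin n) (hij : i ≠ j) : Equiv.Perm (Fin n → G) where
  toFun := hurwitzMove i j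
  invFun := hurwitzMoveInv i j
  left_inv g := by
    funext k
    by_cases h1 : k = i
    · subst h1; simp [hurwitzMove, hurwitzMoveInv, hij.symm]
    · by_cases h2 : k = j
      · subst h2; simp [hurwitzMove, hurwitzMoveInv, h1, mul_assoc]
      · simp [hurwitzMove, hurwitzMoveInv, h1, h2]
  right_inv g := by
    funext k
    by_cases h1 : k = i
    · subst h1; simp [hurwitzMove, hurwitzMoveInv, hij.symm, mul_assoc]
    · by_cases h2 : k = j
      · subst h2; simp [hurwitzMove, hurwitzMoveInv, h1]
      · simp [hurwitzMove, hurwitzMoveInv, h1, h2]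

/-- The action of a standard generator on `Gⁿ`: the letter `i : Fin (n - 1)` (that is, `σ_{i+1}`)
moves the entries at the adjacent positions `i`, `i + 1` (counted from `0`). -/
def hurwitzGen (G : Type*) [Group G] (n : ℕ) (i : Fin (n - 1)) : Equiv.Perm (Fin n → G) :=
  hurwitzPerm ⟨i, by omega⟩ ⟨i + 1, by omega⟩ (by simp)

theorem hurwitzGen_rels (r : FreeGroup (Fin (n - 1))) (hr : r ∈ braidRels n) :
    FreeGroup.lift (hurwitzGen G n) r = 1 := by
  rcases hr with ⟨i, j, hij, rfl⟩ | ⟨i, j, hij, rfl⟩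
  · obtain ⟨i, hi⟩ := i
    obtain ⟨j, hj⟩ := j
    obtain rfl : i + 1 = j := hij
    simp only [map_mul, map_inv, FreeGroup.lift_apply_of]
    rw [mul_inv_eq_one]
    ext g k
    obtain ⟨k, hk⟩ := k
    simp only [Equiv.Perm.mul_apply, hurwitzGen, hurwitzPerm, Equiv.coe_fn_mk, hurwitzMove,
      Fin.mk.injEq]
    have b1 : i ≠ i + 1 + 1 := by omega
    by_cases h1 : k = i
    · subst h1; simp [mul_assoc, b1, b1.symm]
    · by_cases h2 : k = i + 1
      · subst h2; simp [b1, b1.symm]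
      · by_cases h3 : k = i + 1 + 1
        · subst h3; simp [b1, b1.symm]
        · simp [h1, h2, h3]
  · obtain ⟨i, hi⟩ := i
    obtain ⟨j, hj⟩ := j
    replace hij : i + 2 ≤ j := hij
    simp only [map_mul, map_inv, FreeGroup.lift_apply_of]
    rw [mul_inv_eq_one]
    ext g k
    obtain ⟨k, hk⟩ := k
    have a1 : i ≠ j := by omega
    have a2 : i ≠ j + 1 := by omega
    have a3 : i + 1 ≠ j := by omega
    simp only [Equiv.Perm.mul_apply, hurwitzGen, hurwitzPerm, Equiv.coe_fn_mk, hurwitzMove,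
      Fin.mk.injEq]
    by_cases h1 : k = i
    · subst h1; simp [a1, a2, a3]
    · by_cases h2 : k = i + 1
      · subst h2; simp [a1, a2, a3]
      · simp [h1, h2, a1.symm, a3.symm, a2.symm]

end Hurwitz

/-- The Hurwitz action of `Brₙ` on `Gⁿ`, as a left action:
`σᵢ (g₁, …, gₙ) = (g₁, …, gᵢ₋₁, gᵢ gᵢ₊₁ gᵢ⁻¹, gᵢ, gᵢ₊₂, …, gₙ)`. -/
def hurwitz (G : Type*) [Group G] (n : ℕ) : BraidGroup n →* Equiv.Perm (Fin n → G) :=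
  PresentedGroup.toGroup (f := hurwitzGen G n) hurwitzGen_rels

/-- The Hurwitz stabiliser in `Brₙ` of a tuple. -/
def hurwitzStabilizer {G : Type*} [Group G] {n : ℕ} (g : Fin n → G) : Subgroup (BraidGroup n) :=
  (MulAction.stabilizer (Equiv.Perm (Fin n → G)) g).comap (hurwitz G n)

/-- The alternating tuple `(s, t, s, t, …)` of length `n`. -/
def alternating {G : Type*} (s t : G) (n : ℕ) : Fin n → G :=
  fun k => if (k : ℕ) % 2 = 0 then s else t

/-- The matrix entry `m_{ij}`: `3` if `i ≢ j mod 2`, and `1` if `i ≡ j mod 2`. -/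
def altM (i j : ℕ) : ℕ := if i % 2 = j % 2 then 1 else 3

/-- The product `σ_{j-1} σ_{j-2} ⋯ σ_{i+1}` in `Brₙ`. -/
def descProd (n i j : ℕ) : BraidGroup n :=
  ((List.range' (i + 1) (j - 1 - i)).reverse.map (sigma n)).prod

/-- `e_{ij} = σ_{j-1} ⋯ σ_{i+1} σᵢ^{m_{ij}} σ_{i+1}⁻¹ ⋯ σ_{j-1}⁻¹`. -/
def e (n i j : ℕ) : BraidGroup n :=
  descProd n i j * sigma n i ^ altM i j * (descProd n i j)⁻¹

/-- The subgroup `Eₙ` of `Brₙ` generated by all `e_{ij}`, `1 ≤ i < j ≤ n`. -/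
def E (n : ℕ) : Subgroup (BraidGroup n) :=
  Subgroup.closure {b | ∃ i j : ℕ, 1 ≤ i ∧ i < j ∧ j ≤ n ∧ b = e n i j}

/-- The right conjugation action `(b)c = c⁻¹ b c`. -/
def rconj {G : Type*} [Group G] (b c : G) : G := c⁻¹ * b * c

/-- `τ₁ = (σ₁)σ₂σ₃⁻¹σ₄` in `Brₙ`. -/
def tau₁ (n : ℕ) : BraidGroup n :=
  rconj (sigma n 1) (sigma n 2 * (sigma n 3)⁻¹ * sigma n 4)

/-- `τ₂ = (σ₂)σ₃σ₄⁻¹σ₅` in `Brₙ`. -/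
def tau₂ (n : ℕ) : BraidGroup n :=
  rconj (sigma n 2) (sigma n 3 * (sigma n 4)⁻¹ * sigma n 5)

/-- The subgroup `S` of a group is the internal semidirect product of its normal subgroup `N`
and its subgroup `F`. -/
structure IsInternalSemidirectProduct {G : Type*} [Group G] (S N F : Subgroup G) : Prop where
  left_le : N ≤ S
  right_le : F ≤ S
  normal : (N.subgroupOf S).Normal
  isComplement : (N.subgroupOf S).IsComplement' (F.subgroupOf S)

/-- The subgroup `F` is free, and the family `x` is a free generating family of it. -/
structure IsFreelyGeneratedBy {G ι : Type*} [Group G] (F : Subgroup G) (x : ι → G) : Prop where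
  closure_eq : Subgroup.closure (Set.range x) = F
  injective : Function.Injective (FreeGroup.lift x)

end HurwitzBraid

/-!
The three reflections of `𝒮₃` are named by the residues modulo `3`, so that conjugation becomes
`(a, b) ↦ 2a - b` and the Hurwitz action becomes an action of `Brₙ` on lists of residues. The group
`S` in question is the stabiliser of `x = (0, 1, 0, 1, …)`, whose orbit has `80` elements for `n = 5`
and `240` elements for `n = 6`. Four facts give the theorem (`exists_free_complement`).

* `Eₙ` and the `τₖ` lie in `S`. This is read off from words for these elements.
* `S` is generated by `Eₙ` and the `τₖ`. Coset enumeration by the method of Todd and Coxeter, run for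
  the subgroup `H` generated by these elements, produces a complete table whose rows are the
  elements of the orbit of `x`. It follows that `b H` depends only on `b x`, hence `S ≤ H`
  (`CosetTable.IsSound.wordEval_mem`). A partial table is a pair of bit masks; it is sound when
  cosets of `H` can be assigned to its rows in accordance with the known entries, and all steps of
  the enumeration keep it sound.
* `τₖ` and `τₖ⁻¹` normalise `Eₙ`. For every generator `e_{ij}` the braid `τₖ^{±1} e_{ij} τₖ^{∓1}` is
  conjugate under `Eₙ` to some `e_{kl}`. The conjugating elements are listed in `tauOneConj` and
  `tauTwoConj`, and the identities are decided by reversing of braid words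
  (`wordEval_eq_one_of_isTrivial`).
* The quotient of `S` by `Eₙ` is not smaller than free. There is a cocycle on the set of lists of six
  residues with values in the free group on `a₁`, `a₂` (`label`). It vanishes on the braid relators
  (`pathLabel_relatorWords`), hence defines an action of `Br₆` on the product of the two sets
  (`twistedAction`). On the fibre over `x`, the group `E₆` fixes the point `1`, and `τₖ` is left
  multiplication by `aₖ`. So the `τₖ` are free generators and the group they generate meets `E₆`
  trivially. The case `n = 5` uses the same action, restricted to the first five strands.

The cocycle was found by computing the labels of all edges of the orbit relative to a spanning tree
and then changing it by a coboundary so that few labels remain. The group `S / E₆` is generated by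
the half-twists that conjugate to a move on `b, b` in a list `(a, …, a, b, b, a, …, a)`; the label of
such a move depends on `a` only, and the product of the three labels is `1`.

All finite checks are evaluations of Boolean functions by the kernel.
-/

namespace HurwitzBraid

/-! ### Words and word reversing -/

/-- Words in letters indexed by natural numbers; `(i, true)` is the letter `i` and `(i, false)` is
its inverse, as in `FreeGroup.mk`. -/
abbrev Word : Type := List (ℕ × Bool)

section WordEval

variable {G : Type*} [Group G]

/-- The value of a word under an assignment of group elements to the letters. -/
def wordEval (f : ℕ → G) : Word → G
  | [] => 1
  | (i, true) :: w => f i * wordEval f w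
  | (i, false) :: w => (f i)⁻¹ * wordEval f w

@[simp] theorem wordEval_nil (f : ℕ → G) : wordEval f [] = 1 := rfl

@[simp] theorem wordEval_cons_true (f : ℕ → G) (i : ℕ) (w : Word) :
    wordEval f ((i, true) :: w) = f i * wordEval f w := rfl

@[simp] theorem wordEval_cons_false (f : ℕ → G) (i : ℕ) (w : Word) :
    wordEval f ((i, false) :: w) = (f i)⁻¹ * wordEval f w := rfl

@[simp] theorem wordEval_append (f : ℕ → G) (u v : Word) :
    wordEval f (u ++ v) = wordEval f u * wordEval f v := by
  induction u with
  | nil => simp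
  | cons a u ih => obtain ⟨i, _ | _⟩ := a <;> simp [ih, mul_assoc]

@[simp] theorem wordEval_invRev (f : ℕ → G) (w : Word) :
    wordEval f (FreeGroup.invRev w) = (wordEval f w)⁻¹ := by
  induction w with
  | nil => simp
  | cons a w ih =>
    rw [FreeGroup.invRev_cons, wordEval_append, ih]
    obtain ⟨i, _ | _⟩ := a <;> simp [FreeGroup.invRev]

theorem map_wordEval {G' : Type*} [Group G'] (φ : G →* G') (f : ℕ → G) (w : Word) :
    φ (wordEval f w) = wordEval (fun i => φ (f i)) w := by
  induction w with
  | nil => simp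
  | cons a w ih => obtain ⟨i, _ | _⟩ := a <;> simp [ih]

end WordEval

theorem sigma_of_lt {n : ℕ} (i : Fin (n - 1)) :
    sigma n (i + 1) = PresentedGroup.of (rels := braidRels n) i := by
  have : 1 ≤ (i : ℕ) + 1 ∧ (i : ℕ) + 1 < n := by omega
  simp [sigma, this]

theorem sigma_eq_one {n i : ℕ} (h : ¬ (1 ≤ i ∧ i < n)) : sigma n i = 1 := by
  simp [sigma, h]

theorem sigma_comm {n i j : ℕ} (hij : i + 2 ≤ j) :
    sigma n i * sigma n j = sigma n j * sigma n i := by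
  by_cases hi : 1 ≤ i ∧ i < n
  · by_cases hj : 1 ≤ j ∧ j < n
    · rw [sigma, sigma, dif_pos hi, dif_pos hj, ← mul_inv_eq_one]
      exact PresentedGroup.one_of_mem (rels := braidRels n)
        (Or.inr ⟨⟨i - 1, by omega⟩, ⟨j - 1, by omega⟩, by simp; omega, rfl⟩)
    · simp [sigma_eq_one hj]
  · simp [sigma_eq_one hi]

theorem sigma_braid {n i : ℕ} (hi : 1 ≤ i) (hn : i + 1 < n) :
    sigma n i * sigma n (i + 1) * sigma n i =
      sigma n (i + 1) * sigma n i * sigma n (i + 1) := by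
  rw [sigma, sigma, dif_pos ⟨hi, by omega⟩, dif_pos ⟨by omega, hn⟩, ← mul_inv_eq_one]
  exact PresentedGroup.one_of_mem (rels := braidRels n)
    (Or.inl ⟨⟨i - 1, by omega⟩, ⟨i + 1 - 1, by omega⟩, by simp; omega, rfl⟩)

/-- Every braid is the value of a word. -/
theorem exists_wordEval_eq {n : ℕ} (b : BraidGroup n) : ∃ w : Word,
    (∀ a ∈ w, 1 ≤ a.1 ∧ a.1 < n) ∧ wordEval (sigma n) w = b := by
  induction b using PresentedGroup.induction_on with
  | _ z =>
  induction z using FreeGroup.induction_on with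
  | C1 => exact ⟨[], by simp, by simp⟩
  | of i =>
    exact ⟨[(i + 1, true)], by simp; omega, by simp [sigma_of_lt]; rfl⟩
  | inv_of i _ =>
    exact ⟨[(i + 1, false)], by simp; omega, by simp [sigma_of_lt]; rfl⟩
  | mul x y hx hy =>
    obtain ⟨u, hu, eu⟩ := hx
    obtain ⟨v, hv, ev⟩ := hy
    refine ⟨u ++ v, ?_, by simp [eu, ev]⟩
    intro a ha
    rcases List.mem_append.1 ha with h | h
    exacts [hu a h, hv a h]

/-- Right reversing of the word `L.reverse ++ R` in `Brₙ`: the first subword `σₐ⁻¹ σ_b` at the seam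
is replaced by the empty word, by `σ_b σₐ⁻¹` or by `σ_b σₐ σ_b⁻¹ σₐ⁻¹`, according to the distance of
`a` and `b`. When the fuel suffices, the result is a positive word times the inverse of one. -/
def reversing (n : ℕ) : ℕ → Word → Word → Word
  | 0, L, R => L.reverse ++ R
  | _ + 1, L, [] => L.reverse
  | k + 1, [], b :: R => reversing n k [b] R
  | k + 1, (a, false) :: L, (b, true) :: R =>
    bif Nat.beq a b then reversing n k L R
    else bif (Nat.ble (a + 2) b || Nat.ble (b + 2) a) then
      reversing n k L ((b, true) :: (a, false) :: R)
    else bif (Nat.ble 1 a && Nat.ble 1 b && Nat.blt a n && Nat.blt b n) then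
      reversing n k L ((b, true) :: (a, true) :: (b, false) :: (a, false) :: R)
    else reversing n k ((b, true) :: (a, false) :: L) R
  | k + 1, a :: L, b :: R => reversing n k (b :: a :: L) R

theorem wordEval_reversing (n k : ℕ) (L R : Word) :
    wordEval (sigma n) (reversing n k L R) =
      wordEval (sigma n) L.reverse * wordEval (sigma n) R := by
  fun_induction reversing n k L R with
  | case1 L R => simp
  | case2 => simp
  | case3 k b R ih =>
    rw [ih, ← List.singleton_append (x := b) (l := R), wordEval_append]
    simp
  | case4 k a L b R h1 ih =>
    rw [ih]
    obtain rfl := Nat.eq_of_beq_eq_true h1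
    simp [mul_assoc]
  | case5 k a L b R _ h2 ih =>
    rw [ih]
    have key : sigma n a * sigma n b = sigma n b * sigma n a := by
      rcases Bool.or_eq_true_iff.1 h2 with h | h
      · exact sigma_comm (Nat.le_of_ble_eq_true h)
      · exact (sigma_comm (Nat.le_of_ble_eq_true h)).symm
    simp only [List.reverse_cons, wordEval_append, wordEval_cons_true, wordEval_cons_false,
      wordEval_nil, mul_one, mul_assoc]
    congr 1
    rw [eq_inv_mul_iff_mul_eq]
    simp only [← mul_assoc]
    rw [key]; simp
  | case6 k a L b R h1 h2 h3 ih =>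
    rw [ih]
    simp only [Bool.and_eq_true, Nat.ble_eq, Nat.blt_eq] at h3
    rw [← Bool.not_eq_true, Bool.or_eq_true, Nat.ble_eq, Nat.ble_eq] at h2
    have h1' : a ≠ b := by rintro rfl; simp at h1
    have key : sigma n a * sigma n b * sigma n a = sigma n b * sigma n a * sigma n b := by
      rcases Nat.lt_or_gt_of_ne h1' with h | h
      · obtain rfl : b = a + 1 := by omega
        exact sigma_braid (by omega) (by omega)
      · obtain rfl : a = b + 1 := by omega
        exact (sigma_braid (by omega) (by omega)).symm
    simp only [List.reverse_cons, wordEval_append, wordEval_cons_true, wordEval_cons_false,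
      wordEval_nil, mul_one, mul_assoc]
    congr 1
    rw [eq_inv_mul_iff_mul_eq]
    simp only [← mul_assoc]
    rw [key]; simp [mul_assoc]
  | case7 k a L b R _ _ _ ih => rw [ih]; simp [mul_assoc]
  | case8 k a L b R _ ih =>
    rw [ih, ← List.singleton_append (x := b) (l := R)]
    simp only [List.reverse_cons, wordEval_append, mul_assoc]

/-- A test for words that represent `1` in `Brₙ`. If reversing turns `w` into `u v⁻¹` with `u`, `v`
positive, then `w = 1` as soon as `v⁻¹ u` reverses to the empty word. -/
def isTrivial (n : ℕ) (w : Word) : Bool :=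
  let p := reversing n 5000 [] w
  (reversing n 5000 [] (p.dropWhile (fun a => a.2) ++ p.takeWhile (fun a => a.2))).isEmpty

theorem wordEval_eq_one_of_isTrivial {n : ℕ} {w : Word} (h : isTrivial n w = true) :
    wordEval (sigma n) w = 1 := by
  rw [isTrivial, List.isEmpty_iff] at h
  have h1 := wordEval_reversing n 5000 []
    ((reversing n 5000 [] w).dropWhile (fun a => a.2) ++
      (reversing n 5000 [] w).takeWhile (fun a => a.2))
  have h2 := wordEval_reversing n 5000 [] w
  rw [h] at h1
  simp only [List.reverse_nil, wordEval_nil, one_mul, wordEval_append] at h1 h2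
  rw [← h2, ← List.takeWhile_append_dropWhile (p := fun a : ℕ × Bool => a.2)
    (l := reversing n 5000 [] w), wordEval_append]
  exact mul_eq_one_comm.1 h1.symm

/-- A word for `e_{ij}`. -/
def eWord (i j : ℕ) : Word :=
  let d : Word := (List.range' (i + 1) (j - 1 - i)).reverse.map (fun k => (k, true))
  d ++ List.replicate (altM i j) (i, true) ++ FreeGroup.invRev d

theorem wordEval_eWord (n i j : ℕ) : wordEval (sigma n) (eWord i j) = e n i j := by
  have h1 : ∀ l : List ℕ, wordEval (sigma n) (l.map (fun k => (k, true))) =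
      (l.map (sigma n)).prod := by
    intro l
    induction l with
    | nil => simp
    | cons a l ih => simp [ih]
  have h2 : ∀ m : ℕ, wordEval (sigma n) (List.replicate m (i, true)) = sigma n i ^ m := by
    intro m
    induction m with
    | zero => simp
    | succ m ih => simp [List.replicate_succ, ih, pow_succ']
  simp only [eWord, e, descProd, wordEval_append, wordEval_invRev, h1, h2]

/-- Words for `τ₁` (`k = 0`) and `τ₂` (`k = 1`). -/
def tauWord (k : ℕ) : Word :=
  [(k + 4, false), (k + 3, true), (k + 2, false), (k + 1, true), (k + 2, true), (k + 3, false),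
    (k + 4, true)]

theorem wordEval_tauWord_zero (n : ℕ) : wordEval (sigma n) (tauWord 0) = tau₁ n := by
  simp [tauWord, tau₁, rconj, mul_assoc]

theorem wordEval_tauWord_one (n : ℕ) : wordEval (sigma n) (tauWord 1) = tau₂ n := by
  simp [tauWord, tau₂, rconj, mul_assoc]

/-! ### The Hurwitz action on tuples of reflections -/

/-- Labels for the three reflections of `𝒮₃`. They are read as the residues modulo `3`. -/
inductive Color : Type
  | zero
  | one
  | two

namespace Color

/-- The residue modulo `3` of a colour. -/
def toNat : Color → ℕ
  | zero => 0
  | one => 1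
  | two => 2

/-- Conjugation of reflections, `(a, b) ↦ a b a⁻¹`; on residues it is `2a - b`. -/
def conj : Color → Color → Color
  | zero, zero => zero
  | zero, one => two
  | zero, two => one
  | one, zero => two
  | one, one => one
  | one, two => zero
  | two, zero => one
  | two, one => zero
  | two, two => two

theorem conj_conj (a b : Color) : conj a (conj a b) = b := by cases a <;> cases b <;> rfl

theorem conj_distrib (a b c : Color) : conj (conj a b) (conj a c) = conj a (conj b c) := by
  cases a <;> cases b <;> cases c <;> rfl

theorem toNat_lt (a : Color) : a.toNat < 3 := by cases a <;> decide

theorem toNat_injective : Function.Injective toNat := by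
  intro a b h
  cases a <;> cases b <;> first | rfl | exact absurd h (by decide)

end Color

/-- The Hurwitz move of `σᵢ` on a list of colours. It does nothing when the list has no entries at
the positions `i`, `i + 1` (counted from `1`). -/
def move : ℕ → List Color → List Color
  | 1, a :: b :: l => a.conj b :: a :: l
  | i + 2, a :: l => a :: move (i + 1) l
  | _, l => l

/-- The inverse of `move i`. -/
def moveInv : ℕ → List Color → List Color
  | 1, a :: b :: l => b :: b.conj a :: l
  | i + 2, a :: l => a :: moveInv (i + 1) l
  | _, l => l

@[simp] theorem length_move (i : ℕ) (l : List Color) : (move i l).length = l.length := by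
  fun_induction move i l <;> simp_all

@[simp] theorem length_moveInv (i : ℕ) (l : List Color) : (moveInv i l).length = l.length := by
  fun_induction moveInv i l <;> simp_all

@[simp] theorem move_moveInv (i : ℕ) (l : List Color) : move i (moveInv i l) = l := by
  fun_induction moveInv i l with
  | case1 a b l => simp [move, Color.conj_conj]
  | case2 i a l ih => simp [move, ih]
  | case3 i l h1 h2 =>
    unfold move
    split
    · exact absurd rfl (h1 _ _ _ rfl)
    · exact absurd rfl (h2 _ _ _ rfl)
    · rfl

@[simp] theorem moveInv_move (i : ℕ) (l : List Color) : moveInv i (move i l) = l := by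
  fun_induction move i l with
  | case1 a b l => simp [moveInv, Color.conj_conj]
  | case2 i a l ih => simp [moveInv, ih]
  | case3 i l h1 h2 =>
    unfold moveInv
    split
    · exact absurd rfl (h1 _ _ _ rfl)
    · exact absurd rfl (h2 _ _ _ rfl)
    · rfl

theorem move_braid (i : ℕ) (l : List Color) (h : i + 1 < l.length) (hi : 1 ≤ i) :
    move i (move (i + 1) (move i l)) = move (i + 1) (move i (move (i + 1) l)) := by
  induction l generalizing i with
  | nil => simp at h
  | cons a l ih =>
    obtain _ | _ | i := i
    · omega
    · obtain _ | ⟨b, _ | ⟨c, l⟩⟩ := l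
      · simp at h
      · simp at h
      · simp [move, Color.conj_distrib]
    · simp only [move]
      rw [ih (i + 1) (by simpa using h) (by omega)]

theorem move_comm (i j : ℕ) (l : List Color) (h : i + 2 ≤ j) :
    move i (move j l) = move j (move i l) := by
  induction l generalizing i j with
  | nil => simp [move]
  | cons a l ih =>
    obtain ⟨j, rfl⟩ : ∃ k, j = k + 2 := ⟨j - 2, by omega⟩
    obtain _ | _ | i := i
    · simp [move]
    · obtain ⟨j, rfl⟩ : ∃ k, j = k + 1 := ⟨j - 1, by omega⟩
      obtain _ | ⟨b, l⟩ := l <;> simp [move]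
    · simp only [move]
      rw [ih (i + 1) (j + 1) (by omega)]

/-- The action of a word on lists of colours; the last letter acts first. -/
def wordAct : Word → List Color → List Color
  | [], l => l
  | (i, true) :: w, l => move i (wordAct w l)
  | (i, false) :: w, l => moveInv i (wordAct w l)

@[simp] theorem length_wordAct (w : Word) (l : List Color) :
    (wordAct w l).length = l.length := by
  fun_induction wordAct w l <;> simp_all

/-- The list `0, 1, 0, 1, …` of length `n`. -/
def altColors (n : ℕ) : List Color :=
  (List.range n).map (fun k => if k % 2 = 0 then Color.zero else Color.one)

@[simp] theorem length_altColors (n : ℕ) : (altColors n).length = n := by simp [altColors]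

theorem getD_move (i k : ℕ) (l : List Color) (h : i + 1 < l.length) :
    (move (i + 1) l).getD k Color.zero =
      if k = i then (l.getD i Color.zero).conj (l.getD (i + 1) Color.zero)
      else if k = i + 1 then l.getD i Color.zero else l.getD k Color.zero := by
  induction l generalizing i k with
  | nil => simp at h
  | cons a l ih =>
    obtain _ | i := i
    · obtain _ | ⟨b, l⟩ := l
      · simp at h
      · obtain _ | _ | k := k <;> simp [move]
    · obtain _ | k := k
      · simp [move]
      · simp only [move, List.getD_cons_succ]
        rw [ih i k (by simpa using h)]
        simp

section Tuple

variable {C : Type*} [Group C]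

/-- The reflections `s`, `t`, `sts` named by the colours `0`, `1`, `2`. -/
def reflectionOf (s t : C) : Color → C
  | .zero => s
  | .one => t
  | .two => s * t * s

/-- The tuple of reflections named by a list of colours. -/
def tupleOf (s t : C) (n : ℕ) (l : List Color) : Fin n → C :=
  fun k => reflectionOf s t (l.getD k Color.zero)

theorem tupleOf_altColors (s t : C) (n : ℕ) : tupleOf s t n (altColors n) = alternating s t n := by
  funext k
  by_cases h : (k : ℕ) % 2 = 0 <;> simp [tupleOf, altColors, alternating, reflectionOf, h]

variable {s t : C}

theorem reflectionOf_conj (hs : s * s = 1) (ht : t * t = 1) (hst : s * t * s = t * s * t)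
    (a b : Color) : reflectionOf s t a * reflectionOf s t b * (reflectionOf s t a)⁻¹ =
      reflectionOf s t (a.conj b) := by
  have hs' : ∀ x : C, s * (s * x) = x := fun x => by rw [← mul_assoc, hs, one_mul]
  have ht' : ∀ x : C, t * (t * x) = x := fun x => by rw [← mul_assoc, ht, one_mul]
  simp only [mul_assoc] at hst
  have hst' : ∀ x : C, t * (s * (t * x)) = s * (t * (s * x)) := fun x => by
    have := congrArg (· * x) hst
    simpa [mul_assoc] using this.symm
  rw [mul_inv_eq_iff_eq_mul]
  cases a <;> cases b <;> simp [reflectionOf, Color.conj, mul_assoc, hs, ht, hs', ht', hst', ← hst]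

theorem reflectionOf_injective (hs : s * s = 1) (hst : s * t * s = t * s * t)
    (hne : s ≠ t) : Function.Injective (reflectionOf s t) := by
  have h1 : s * t * s ≠ s := fun h => hne <| by
    have : s * t = 1 := by simpa using h
    rw [← mul_left_cancel_iff (a := s), this, hs]
  have h2 : s * t * s ≠ t := fun h => hne <| by
    have h3 : t * s = 1 := by simpa using hst.symm.trans h
    rw [← mul_right_cancel_iff (a := s), h3, hs]
  intro a b h
  cases a <;> cases b <;> simp only [reflectionOf] at h <;>
    first | rfl | exact absurd h hne | exact absurd h.symm hne | exact absurd h h1 |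
      exact absurd h.symm h1 | exact absurd h h2 | exact absurd h.symm h2

theorem tupleOf_injective {n : ℕ} (h : Function.Injective (reflectionOf s t)) {l l' : List Color}
    (hl : l.length = n) (hl' : l'.length = n) (e : tupleOf s t n l = tupleOf s t n l') :
    l = l' := by
  refine List.ext_getElem (hl.trans hl'.symm) fun k hk hk' => ?_
  have := h (congrFun e ⟨k, by omega⟩)
  simpa [hk, hk'] using this

theorem hurwitz_sigma_tupleOf
    (hc : ∀ a b : Color, reflectionOf s t a * reflectionOf s t b * (reflectionOf s t a)⁻¹ =
      reflectionOf s t (a.conj b)) {n i : ℕ} (h1 : 1 ≤ i) (hn : i < n) {l : List Color}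
    (hl : l.length = n) :
    hurwitz C n (sigma n i) (tupleOf s t n l) = tupleOf s t n (move i l) := by
  obtain ⟨i, rfl⟩ : ∃ k, i = k + 1 := ⟨i - 1, by omega⟩
  rw [sigma, dif_pos ⟨h1, hn⟩, hurwitz]
  erw [PresentedGroup.toGroup.of]
  funext k
  rw [tupleOf, getD_move i k l (by omega)]
  simp only [hurwitzGen, hurwitzPerm, Equiv.coe_fn_mk, hurwitzMove, tupleOf, hc, Fin.ext_iff,
    Nat.add_sub_cancel]
  split_ifs <;> rfl

theorem hurwitz_wordEval_tupleOf
    (hc : ∀ a b : Color, reflectionOf s t a * reflectionOf s t b * (reflectionOf s t a)⁻¹ =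
      reflectionOf s t (a.conj b)) {n : ℕ} {w : Word} (hw : ∀ a ∈ w, 1 ≤ a.1 ∧ a.1 < n)
    {l : List Color} (hl : l.length = n) :
    hurwitz C n (wordEval (sigma n) w) (tupleOf s t n l) = tupleOf s t n (wordAct w l) := by
  induction w with
  | nil => simp [wordAct]
  | cons a w ih =>
    have ha := hw a (by simp)
    have ih := ih fun b hb => hw b (by simp [hb])
    obtain ⟨i, _ | _⟩ := a
    · simp only [wordEval_cons_false, map_mul, map_inv, Equiv.Perm.mul_apply, ih, wordAct]
      rw [Equiv.Perm.inv_eq_iff_eq, hurwitz_sigma_tupleOf hc ha.1 ha.2 (by simpa using hl),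
        move_moveInv]
    · simp only [wordEval_cons_true, map_mul, Equiv.Perm.mul_apply, ih, wordAct]
      rw [hurwitz_sigma_tupleOf hc ha.1 ha.2 (by simpa using hl)]

/-- A word represents an element of the stabiliser of the alternating tuple exactly when it fixes
the alternating list of colours. -/
theorem wordEval_mem_hurwitzStabilizer (hs : s * s = 1) (ht : t * t = 1)
    (hst : s * t * s = t * s * t) (hne : s ≠ t) {n : ℕ} {w : Word}
    (hw : ∀ a ∈ w, 1 ≤ a.1 ∧ a.1 < n) :
    wordEval (sigma n) w ∈ hurwitzStabilizer (alternating s t n) ↔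
      wordAct w (altColors n) = altColors n := by
  rw [hurwitzStabilizer, Subgroup.mem_comap, MulAction.mem_stabilizer_iff, Equiv.Perm.smul_def,
    ← tupleOf_altColors, hurwitz_wordEval_tupleOf (reflectionOf_conj hs ht hst) hw (by simp)]
  exact ⟨fun h => tupleOf_injective (reflectionOf_injective hs hst hne) (by simp) (by simp) h,
    fun h => by rw [h]⟩

end Tuple

/-! ### Coset enumeration over the orbit of the alternating list -/

/-- The number with ternary digits `l`, least significant digit first. -/
def code : List Color → ℕ
  | [] => 0
  | a :: l => a.toNat + 3 * code l

theorem code_injective {l l' : List Color} (hl : l.length = l'.length) (h : code l = code l') :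
    l = l' := by
  induction l generalizing l' with
  | nil => exact (List.eq_nil_of_length_eq_zero (by simpa using hl.symm)).symm
  | cons a l ih =>
    obtain _ | ⟨b, l'⟩ := l'
    · simp at hl
    · have ha := a.toNat_lt
      have hb := b.toNat_lt
      simp only [code] at h
      rw [Color.toNat_injective (show a.toNat = b.toNat by omega),
        ih (by simpa using hl) (by omega)]

/-- All lists of colours of length `n`. -/
def allColorLists : ℕ → List (List Color)
  | 0 => [[]]
  | n + 1 => [Color.zero, .one, .two].flatMap fun a => (allColorLists n).map (a :: ·)

theorem mem_allColorLists {n : ℕ} {l : List Color} (hl : l.length = n) : l ∈ allColorLists n := by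
  induction n generalizing l with
  | zero => simp [allColorLists, List.eq_nil_of_length_eq_zero hl]
  | succ n ih =>
    obtain _ | ⟨a, l⟩ := l
    · simp at hl
    · exact List.mem_flatMap.2 ⟨a, by cases a <;> simp,
        List.mem_map_of_mem (ih (by simpa using hl))⟩

/-- A partial coset table, whose rows are lists of colours of length `n`. Bit `code l` of `verts`
says that the row `l` is in use, and bit `code l * n + i` of `edges` that the entry of row `l` in
column `σᵢ` has been found to be `move i l`. -/
structure CosetTable where
  verts : ℕ
  edges : ℕ

namespace CosetTable

variable {n : ℕ}

/-- The row `l` is in use. -/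
def hasVert (T : CosetTable) (l : List Color) : Bool := T.verts.testBit (code l)

/-- The entry of row `l` in column `σᵢ` is known. -/
def hasEdge (n : ℕ) (T : CosetTable) (l : List Color) (i : ℕ) : Bool :=
  Nat.blt i n && T.edges.testBit (code l * n + i)

/-- Mark the row `l` as used. -/
def addVert (T : CosetTable) (l : List Color) : CosetTable := ⟨T.verts ||| 2 ^ code l, T.edges⟩

/-- Mark the entry of row `l` in column `σᵢ` as known. -/
def addEdge (n : ℕ) (T : CosetTable) (l : List Color) (i : ℕ) : CosetTable :=
  ⟨T.verts, T.edges ||| 2 ^ (code l * n + i)⟩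

/-- The row that the word `w` leads to from `l`, provided all entries on the way are known. -/
def track (n : ℕ) (T : CosetTable) : Word → List Color → Option (List Color)
  | [], l => some l
  | (i, true) :: w, l =>
    match track n T w l with
    | none => none
    | some l' => bif hasEdge n T l' i then some (move i l') else none
  | (i, false) :: w, l =>
    match track n T w l with
    | none => none
    | some l' => bif hasEdge n T (moveInv i l') i then some (moveInv i l') else none

/-- Use a new row for the neighbour `σᵢ l` of the row `l`. -/
def defineFwd (n : ℕ) (l : List Color) (T : CosetTable) (i : ℕ) : CosetTable :=
  bif T.hasVert (move i l) then T else (T.addVert (move i l)).addEdge n l i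

/-- Use a new row for the neighbour `σᵢ⁻¹ l` of the row `l`. -/
def defineBwd (n : ℕ) (l : List Color) (T : CosetTable) (i : ℕ) : CosetTable :=
  bif T.hasVert (moveInv i l) then T else (T.addVert (moveInv i l)).addEdge n (moveInv i l) i

/-- Deduce an entry from the relation `σ_g U = V` at the row `l`, for `r = (g, U, V)`. -/
def deduce (n : ℕ) (l : List Color) (T : CosetTable) (r : ℕ × Word × Word) : CosetTable :=
  match track n T r.2.1 l with
  | none => T
  | some a =>
    bif hasEdge n T a r.1 then T else
      match track n T r.2.2 l with
      | none => T
      | some b => bif Nat.beq (code b) (code (move r.1 a)) then T.addEdge n a r.1 else T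

/-- `k a`, with `a` evaluated first: the case distinction makes the kernel reduce `a` to a numeral
before it is substituted. -/
def forceNat {α : Type*} (a : ℕ) (k : ℕ → α) : α :=
  match a with
  | 0 => k 0
  | a + 1 => k (a + 1)

theorem forceNat_eq {α : Type*} (a : ℕ) (k : ℕ → α) : forceNat a k = k a := by cases a <;> rfl

/-- The left fold over a list, with the table evaluated before every step. -/
def fold {α : Type*} (f : CosetTable → α → CosetTable) : List α → CosetTable → CosetTable
  | [], T => T
  | a :: L, T => forceNat T.verts fun v => forceNat T.edges fun e => fold f L (f ⟨v, e⟩ a)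

/-- Define all neighbours of the row `l`, then deduce entries from the relations `rels` at it. -/
def process (n : ℕ) (rels : List (ℕ × Word × Word)) (T : CosetTable) (l : List Color) :
    CosetTable :=
  bif T.hasVert l then
    fold (deduce n l) rels (fold (defineBwd n l) (List.range' 1 (n - 1))
      (fold (defineFwd n l) (List.range' 1 (n - 1)) T))
  else T

/-- Rounds of coset enumeration: every round scans the subgroup relations `subs` at the alternating
list and then processes all lists. -/
def rounds (n : ℕ) (rels subs : List (ℕ × Word × Word)) : ℕ → CosetTable → CosetTable
  | 0, T => T
  | k + 1, T =>
    rounds n rels subs k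
      (fold (process n rels) (allColorLists n) (fold (deduce n (altColors n)) subs T))

/-- The table whose only row is the alternating list. -/
def init (n : ℕ) : CosetTable := ⟨2 ^ code (altColors n), 0⟩

/-- All entries are known. -/
def isComplete (n : ℕ) (T : CosetTable) : Bool :=
  (allColorLists n).all fun l => !T.hasVert l ||
    (List.range' 1 (n - 1)).all fun i => hasEdge n T l i && T.hasVert (moveInv i l)

/-- A table is sound for the subgroup `H` if left cosets of `H` can be assigned to its rows such
that the alternating list is assigned `H` and all known entries are right. -/
def IsSound (H : Subgroup (BraidGroup n)) (T : CosetTable) : Prop :=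
  ∃ p : ℕ → BraidGroup n ⧸ H, p (code (altColors n)) = ((1 : BraidGroup n) : BraidGroup n ⧸ H) ∧
    T.hasVert (altColors n) = true ∧
    ∀ l : List Color, l.length = n → ∀ i : ℕ, hasEdge n T l i = true →
      T.hasVert l = true ∧ T.hasVert (move i l) = true ∧
        sigma n i • p (code l) = p (code (move i l))

theorem hasVert_addVert (T : CosetTable) (l l' : List Color) :
    (T.addVert l).hasVert l' = true ↔ T.hasVert l' = true ∨ code l = code l' := by
  simp [hasVert, addVert, Nat.testBit_or, Nat.testBit_two_pow]

theorem hasVert_addEdge (T : CosetTable) (l l' : List Color) (i : ℕ) :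
    (addEdge n T l i).hasVert l' = T.hasVert l' := rfl

theorem hasEdge_addEdge {T : CosetTable} {l l' : List Color} {i j : ℕ} (hi : i < n)
    (hl : l.length = l'.length) (h : hasEdge n (addEdge n T l i) l' j = true) :
    hasEdge n T l' j = true ∨ (l' = l ∧ j = i) := by
  simp only [hasEdge, addEdge, Nat.testBit_or, Nat.testBit_two_pow, Bool.and_eq_true,
    Nat.blt_eq, Bool.or_eq_true, decide_eq_true_eq] at h ⊢
  obtain ⟨hj, h | h⟩ := h
  · exact Or.inl ⟨hj, h⟩
  · have hmod := congrArg (· % n) h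
    have hdiv := congrArg (· / n) h
    simp only [Nat.mul_add_mod, Nat.mod_eq_of_lt hi, Nat.mod_eq_of_lt hj,
      mul_comm _ n, Nat.mul_add_div (show 0 < n by omega), Nat.div_eq_of_lt hi,
      Nat.div_eq_of_lt hj, add_zero] at hmod hdiv
    exact Or.inr ⟨(code_injective hl hdiv).symm, hmod.symm⟩

variable {H : Subgroup (BraidGroup n)} {T : CosetTable}

theorem isSound_init : IsSound H (init n) := by
  refine ⟨fun _ => ((1 : BraidGroup n) : BraidGroup n ⧸ H), rfl, by simp [hasVert, init], ?_⟩
  intro l _ i h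
  simp [hasEdge, init] at h

/-- Soundness survives the definition of a row: the coset of the new row is chosen to make the new
entry right, and no known entry involves the new row. -/
theorem IsSound.defineFwd (hT : IsSound H T) {l : List Color} (hl : l.length = n) {i : ℕ}
    (hi : i < n) (hv : T.hasVert l = true) : IsSound H (defineFwd n l T i) := by
  rw [CosetTable.defineFwd]
  cases hc : T.hasVert (move i l)
  swap
  · exact hT
  obtain ⟨p, h1, h2, h3⟩ := hT
  have hne : ∀ l', T.hasVert l' = true → code l' ≠ code (move i l) := by
    intro l' hl' e
    rw [hasVert, ← e] at hc
    rw [hasVert, hc] at hl'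
    simp at hl'
  refine ⟨Function.update p (code (move i l)) (sigma n i • p (code l)), ?_, ?_, ?_⟩
  · rw [Function.update_of_ne (hne _ h2), h1]
  · simp only [cond_false, hasVert_addEdge, hasVert_addVert, h2, true_or]
  · intro l' hl' j hj
    simp only [cond_false, hasVert_addEdge, hasVert_addVert] at hj ⊢
    rcases hasEdge_addEdge hi (hl.trans hl'.symm) hj with hj | ⟨rfl, rfl⟩
    · obtain ⟨a, b, c⟩ := h3 l' hl' j hj
      exact ⟨Or.inl a, Or.inl b, by
        rw [Function.update_of_ne (hne _ a), Function.update_of_ne (hne _ b), c]⟩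
    · exact ⟨Or.inl hv, Or.inr rfl, by
        rw [Function.update_of_ne (hne _ hv), Function.update_self]⟩

theorem IsSound.defineBwd (hT : IsSound H T) {l : List Color} (hl : l.length = n) {i : ℕ}
    (hi : i < n) (hv : T.hasVert l = true) : IsSound H (defineBwd n l T i) := by
  rw [CosetTable.defineBwd]
  cases hc : T.hasVert (moveInv i l)
  swap
  · exact hT
  obtain ⟨p, h1, h2, h3⟩ := hT
  have hne : ∀ l', T.hasVert l' = true → code l' ≠ code (moveInv i l) := by
    intro l' hl' e
    rw [hasVert, ← e] at hc
    rw [hasVert, hc] at hl'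
    simp at hl'
  refine ⟨Function.update p (code (moveInv i l)) ((sigma n i)⁻¹ • p (code l)), ?_, ?_, ?_⟩
  · rw [Function.update_of_ne (hne _ h2), h1]
  · simp only [cond_false, hasVert_addEdge, hasVert_addVert, h2, true_or]
  · intro l' hl' j hj
    simp only [cond_false, hasVert_addEdge, hasVert_addVert] at hj ⊢
    rcases hasEdge_addEdge hi (by simp [hl, hl']) hj with hj | ⟨rfl, rfl⟩
    · obtain ⟨a, b, c⟩ := h3 l' hl' j hj
      exact ⟨Or.inl a, Or.inl b, by
        rw [Function.update_of_ne (hne _ a), Function.update_of_ne (hne _ b), c]⟩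
    · rw [move_moveInv]
      exact ⟨Or.inr rfl, Or.inl hv, by
        rw [Function.update_of_ne (hne _ hv), Function.update_self, smul_inv_smul]⟩

/-- Following known entries along a word multiplies the assigned coset by the value of the word. -/
theorem track_spec {p : ℕ → BraidGroup n ⧸ H}
    (h : ∀ l : List Color, l.length = n → ∀ i : ℕ, hasEdge n T l i = true →
      T.hasVert l = true ∧ T.hasVert (move i l) = true ∧
        sigma n i • p (code l) = p (code (move i l)))
    {l : List Color} (hl : l.length = n) (hv : T.hasVert l = true) {w : Word} {l' : List Color}
    (hw : track n T w l = some l') :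
    l'.length = n ∧ T.hasVert l' = true ∧ wordEval (sigma n) w • p (code l) = p (code l') := by
  induction w generalizing l' with
  | nil =>
    obtain rfl : l = l' := by simpa [track] using hw
    exact ⟨hl, hv, by simp⟩
  | cons a w ih =>
    obtain ⟨i, _ | _⟩ := a
    · rw [track] at hw
      cases e : track n T w l with
      | none => simp [e] at hw
      | some l₁ =>
        rw [e] at hw
        obtain ⟨a1, a2, a3⟩ := ih e
        cases c : hasEdge n T (moveInv i l₁) i
        · simp [c] at hw
        · obtain rfl : moveInv i l₁ = l' := by simpa [c] using hw
          obtain ⟨b1, b2, b3⟩ := h _ (by simpa using a1) i c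
          rw [move_moveInv] at b3
          refine ⟨by simpa using a1, b1, ?_⟩
          rw [wordEval_cons_false, mul_smul, a3, ← b3, inv_smul_smul]
    · rw [track] at hw
      cases e : track n T w l with
      | none => simp [e] at hw
      | some l₁ =>
        rw [e] at hw
        obtain ⟨a1, a2, a3⟩ := ih e
        cases c : hasEdge n T l₁ i
        · simp [c] at hw
        · obtain rfl : move i l₁ = l' := by simpa [c] using hw
          obtain ⟨b1, b2, b3⟩ := h _ a1 i c
          refine ⟨by simpa using a1, b2, ?_⟩
          rw [wordEval_cons_true, mul_smul, a3, b3]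

/-- Soundness survives a deduction from a relation that holds at the coset of the row `l`. A
relation for an element of `H` holds at the coset `H`, which belongs to the alternating list. -/
theorem IsSound.deduce (hT : IsSound H T) {l : List Color} (hl : l.length = n)
    (hv : T.hasVert l = true) {r : ℕ × Word × Word} (hr : r.1 < n)
    (h : ∀ q : BraidGroup n ⧸ H, (l = altColors n → q = ((1 : BraidGroup n) : BraidGroup n ⧸ H)) →
      sigma n r.1 • wordEval (sigma n) r.2.1 • q = wordEval (sigma n) r.2.2 • q) :
    IsSound H (deduce n l T r) := by
  rw [CosetTable.deduce]
  split
  · exact hT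
  rename_i a ea
  cases hasEdge n T a r.1
  swap
  · exact hT
  split
  · exact hT
  rename_i b eb
  cases hb : Nat.beq (code b) (code (move r.1 a))
  · exact hT
  obtain ⟨p, h1, h2, h3⟩ := hT
  obtain ⟨a1, a2, a3⟩ := track_spec h3 hl hv ea
  obtain ⟨b1, b2, b3⟩ := track_spec h3 hl hv eb
  obtain rfl : b = move r.1 a :=
    code_injective (by simp [a1, b1]) (Nat.eq_of_beq_eq_true hb)
  refine ⟨p, h1, h2, ?_⟩
  intro l' hl' j hj
  rcases hasEdge_addEdge hr (a1.trans hl'.symm) hj with hj | ⟨rfl, rfl⟩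
  · exact h3 l' hl' j hj
  · refine ⟨a2, b2, ?_⟩
    rw [← a3, h _ (by rintro rfl; exact h1), b3]

theorem hasVert_defineFwd {l l' : List Color} {i : ℕ} (hv : T.hasVert l' = true) :
    (CosetTable.defineFwd n l T i).hasVert l' = true := by
  rw [CosetTable.defineFwd]
  cases T.hasVert (move i l)
  · simp only [cond_false, hasVert_addEdge, hasVert_addVert, hv, true_or]
  · exact hv

theorem hasVert_defineBwd {l l' : List Color} {i : ℕ} (hv : T.hasVert l' = true) :
    (CosetTable.defineBwd n l T i).hasVert l' = true := by
  rw [CosetTable.defineBwd]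
  cases T.hasVert (moveInv i l)
  · simp only [cond_false, hasVert_addEdge, hasVert_addVert, hv, true_or]
  · exact hv

theorem hasVert_deduce {l l' : List Color} {r : ℕ × Word × Word} :
    (CosetTable.deduce n l T r).hasVert l' = T.hasVert l' := by
  rw [CosetTable.deduce]
  split
  · rfl
  cases hasEdge n T _ r.1
  · simp only [cond_false]
    split
    · rfl
    · cases Nat.beq _ _ <;> rfl
  · rfl

theorem fold_invariant {α : Type*} {P : CosetTable → Prop} {f : CosetTable → α → CosetTable}
    {L : List α} (hf : ∀ T, P T → ∀ a ∈ L, P (f T a)) (h : P T) : P (fold f L T) := by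
  induction L generalizing T with
  | nil => exact h
  | cons a L ih =>
    rw [fold, forceNat_eq, forceNat_eq]
    exact ih (fun T hT b hb => hf T hT b (by simp [hb])) (hf T h a (by simp))

theorem IsSound.process (hT : IsSound H T) {rels : List (ℕ × Word × Word)}
    (hrels : ∀ r ∈ rels, r.1 < n ∧
      sigma n r.1 * wordEval (sigma n) r.2.1 = wordEval (sigma n) r.2.2)
    {l : List Color} (hl : l.length = n) : IsSound H (process n rels T l) := by
  rw [CosetTable.process]
  cases hv : T.hasVert l
  · exact hT
  rw [cond_true]
  refine (fold_invariant (P := fun T => IsSound H T ∧ T.hasVert l = true) ?_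
    (fold_invariant (P := fun T => IsSound H T ∧ T.hasVert l = true) ?_
    (fold_invariant (P := fun T => IsSound H T ∧ T.hasVert l = true) ?_ ⟨hT, hv⟩))).1
  · rintro T ⟨hT, hv⟩ r hr
    refine ⟨hT.deduce hl hv (hrels r hr).1 fun q _ => ?_, by rw [hasVert_deduce, hv]⟩
    rw [← mul_smul, (hrels r hr).2]
  · rintro T ⟨hT, hv⟩ i hi
    rw [List.mem_range'_1] at hi
    exact ⟨hT.defineBwd hl (by omega) hv, hasVert_defineBwd hv⟩
  · rintro T ⟨hT, hv⟩ i hi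
    rw [List.mem_range'_1] at hi
    exact ⟨hT.defineFwd hl (by omega) hv, hasVert_defineFwd hv⟩

theorem length_of_mem_allColorLists {l : List Color} (h : l ∈ allColorLists n) :
    l.length = n := by
  induction n generalizing l with
  | zero => simpa [allColorLists] using h
  | succ n ih =>
    obtain ⟨a, -, h⟩ := List.mem_flatMap.1 h
    obtain ⟨l', h', rfl⟩ := List.mem_map.1 h
    simp [ih h']

theorem IsSound.rounds (hT : IsSound H T) {rels subs : List (ℕ × Word × Word)}
    (hrels : ∀ r ∈ rels, r.1 < n ∧
      sigma n r.1 * wordEval (sigma n) r.2.1 = wordEval (sigma n) r.2.2)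
    (hsubs : ∀ r ∈ subs, r.1 < n ∧
      (wordEval (sigma n) r.2.2)⁻¹ * (sigma n r.1 * wordEval (sigma n) r.2.1) ∈ H) (k : ℕ) :
    IsSound H (rounds n rels subs k T) := by
  induction k generalizing T with
  | zero => exact hT
  | succ k ih =>
    refine ih (fold_invariant (fun T hT l hl => hT.process hrels (length_of_mem_allColorLists hl))
      (fold_invariant (fun T hT r hr => ?_) hT))
    refine hT.deduce (by simp) hT.choose_spec.2.1 (hsubs r hr).1 fun q hq => ?_
    rw [hq rfl, ← mul_smul, MulAction.Quotient.smul_coe, MulAction.Quotient.smul_coe, eq_comm,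
      QuotientGroup.eq]
    simpa using (hsubs r hr).2

/-- If a complete table is sound for `H`, then all words that fix the alternating list represent
elements of `H`. -/
theorem IsSound.wordEval_mem (hT : IsSound H T) (hc : isComplete n T = true) {w : Word}
    (hw : ∀ a ∈ w, 1 ≤ a.1 ∧ a.1 < n) (h : wordAct w (altColors n) = altColors n) :
    wordEval (sigma n) w ∈ H := by
  obtain ⟨p, h1, h2, h3⟩ := hT
  have hc' : ∀ l : List Color, l.length = n → T.hasVert l = true → ∀ i, 1 ≤ i → i < n →
      hasEdge n T l i = true ∧ T.hasVert (moveInv i l) = true := by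
    intro l hl hv i hi hn
    have := List.all_eq_true.1 hc l (mem_allColorLists hl)
    rw [hv, Bool.not_true, Bool.false_or, List.all_eq_true] at this
    simpa using this i (List.mem_range'_1.2 (by omega))
  have key : T.hasVert (wordAct w (altColors n)) = true ∧
      wordEval (sigma n) w • p (code (altColors n)) = p (code (wordAct w (altColors n))) := by
    clear h
    induction w with
    | nil => exact ⟨h2, by simp [wordAct]⟩
    | cons a w ih =>
      have ha := hw a (by simp)
      obtain ⟨i1, i2⟩ := ih fun b hb => hw b (by simp [hb])
      obtain ⟨e1, e2⟩ := hc' _ (by simp) i1 a.1 ha.1 ha.2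
      obtain ⟨i, _ | _⟩ := a
      · obtain ⟨f1, -⟩ := hc' _ (by simp) e2 i ha.1 ha.2
        have := (h3 _ (by simp) i f1).2.2
        simp only [wordEval_cons_false, wordAct, mul_smul, i2]
        refine ⟨e2, ?_⟩
        rw [← inv_smul_eq_iff.2 this.symm, move_moveInv]
      · obtain ⟨-, f1, f2⟩ := h3 _ (by simp) i e1
        simp only [wordEval_cons_true, wordAct, mul_smul, i2]
        exact ⟨f1, f2⟩
  have := key.2
  rw [h, h1, MulAction.Quotient.smul_coe, eq_comm, QuotientGroup.eq] at this
  simpa using this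

end CosetTable

/-- The relations `σ_g U = V` obtained by solving `w = 1` for one of its letters `σ_g`. -/
def splits (w : Word) : List (ℕ × Word × Word) :=
  (List.range w.length).map fun k =>
    match w.drop k with
    | [] => (0, [], [])
    | (g, true) :: B => (g, B, FreeGroup.invRev (w.take k))
    | (g, false) :: B => (g, FreeGroup.invRev (w.take k), B)

theorem exists_of_mem_splits {w : Word} {r : ℕ × Word × Word} (h : r ∈ splits w) :
    ∃ A B : Word, (w = A ++ (r.1, true) :: B ∧ r.2.1 = B ∧ r.2.2 = FreeGroup.invRev A) ∨
      (w = A ++ (r.1, false) :: B ∧ r.2.1 = FreeGroup.invRev A ∧ r.2.2 = B) := by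
  obtain ⟨k, hk, rfl⟩ := List.mem_map.1 h
  have e := List.take_append_drop k w
  rw [List.mem_range] at hk
  split
  · rename_i h0
    rw [List.drop_eq_nil_iff] at h0
    omega
  · rename_i g B h0
    exact ⟨w.take k, B, Or.inl ⟨by rw [← h0, e], rfl, rfl⟩⟩
  · rename_i g B h0
    exact ⟨w.take k, B, Or.inr ⟨by rw [← h0, e], rfl, rfl⟩⟩

/-- Words for the defining relators of `Brₙ`. -/
def relatorWords (n : ℕ) : List Word :=
  (List.range' 1 (n - 1)).flatMap fun i => (List.range' (i + 1) (n - 1 - i)).map fun j =>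
    if j = i + 1 then
      [(i, true), (j, true), (i, true), (j, false), (i, false), (j, false)]
    else [(i, true), (j, true), (i, false), (j, false)]

/-- Words for the generators of `Eₙ`. -/
def eWords (n : ℕ) : List Word :=
  (List.range' 1 (n - 1)).flatMap fun i => (List.range' (i + 1) (n - i)).map fun j => eWord i j

/-! ### A cocycle with values in the free group of rank two -/

namespace Color

/-- The colour with the next residue modulo `3`. -/
def succ : Color → Color
  | zero => one
  | one => two
  | two => zero

/-- Equality of colours as a Boolean. -/
def beq (a b : Color) : Bool := Nat.beq a.toNat b.toNat

/-- Words in the two letters `0`, `1` for three elements of a free group of rank two, one for every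
colour, whose product is `1`. -/
def word : Color → Word
  | zero => [(1, true)]
  | one => [(0, true)]
  | two => [(0, false), (1, false)]

end Color

/-- The value of the cocycle at `σᵢ` and a list of six colours. At a list
`(a, …, a, b, b, a, …, a)` with `a ≠ b`, which is fixed by the move at `b, b`, the label of this move
is the element named by `a`; no coboundary could make it trivial. The labels of moves that change the
list are those that the braid relations then force, in a choice that keeps most of them trivial. -/
def label : ℕ → List Color → Word
  | 1, [p, q, r, s, t, u] =>
    bif p.beq q && !p.beq r && r.beq s && r.beq t && r.beq u then r.word else []
  | 2, [p, q, r, s, t, u] =>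
    bif s.beq t && s.beq u then
      bif p.beq s && q.beq r && !q.beq s then s.word
      else bif p.beq s.succ && q.beq p.succ && r.beq p then s.word
      else bif p.beq s.succ && q.beq s && r.beq p.succ then FreeGroup.invRev s.word
      else []
    else []
  | 3, [p, q, r, s, t, u] =>
    bif p.beq q.succ && r.beq s.succ && t.beq u.succ then FreeGroup.invRev r.word
    else bif p.beq q.succ && s.beq r.succ && t.beq u then
      bif r.beq t.succ then t.word
      else bif t.beq r.succ then FreeGroup.invRev t.word
      else []
    else bif p.beq q && s.beq r.succ && t.beq u.succ then
      bif p.beq r.succ then p.word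
      else bif r.beq p.succ then FreeGroup.invRev p.word
      else []
    else bif p.beq q && r.beq s && t.beq u && p.beq t && !p.beq r then p.word
    else []
  | 4, [p, q, r, s, t, u] =>
    bif p.beq q && p.beq r then
      bif u.beq p && s.beq t && !s.beq p then p.word
      else bif s.beq p.succ && t.beq p && u.beq s.succ then p.word
      else bif t.beq p.succ && s.beq t.succ && u.beq s then FreeGroup.invRev p.word
      else []
    else []
  | 5, [p, q, r, s, t, u] =>
    bif p.beq q && p.beq r && p.beq s && t.beq u && !t.beq p then p.word else []
  | _, _ => []

/-- The value of the cocycle at a word and a list of colours, by the rule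
`c (v w, l) = c (v, w l) c (w, l)`. -/
def pathLabel : Word → List Color → Word
  | [], _ => []
  | (i, true) :: w, l => label i (wordAct w l) ++ pathLabel w l
  | (i, false) :: w, l => FreeGroup.invRev (label i (moveInv i (wordAct w l))) ++ pathLabel w l

/-- Free reduction of a word. -/
def freeReduce : Word → Word
  | [] => []
  | a :: w =>
    match freeReduce w with
    | [] => [a]
    | b :: w' => bif Nat.beq a.1 b.1 && (a.2 ^^ b.2) then w' else a :: b :: w'

theorem wordEval_freeReduce {G : Type*} [Group G] (f : ℕ → G) (w : Word) :
    wordEval f (freeReduce w) = wordEval f w := by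
  fun_induction freeReduce w with
  | case1 => rfl
  | case2 a w h ih =>
    rw [← List.singleton_append (x := a) (l := w), wordEval_append, ← ih, h]
    simp
  | case3 a w b w' h hab ih =>
    rw [← List.singleton_append (x := a) (l := w), wordEval_append, ← ih, h]
    obtain ⟨i, s⟩ := a
    obtain ⟨j, t⟩ := b
    rw [Bool.and_eq_true] at hab
    obtain ⟨h1, h2⟩ := hab
    obtain rfl : i = j := Nat.eq_of_beq_eq_true h1
    cases s <;> cases t <;> simp at h2 ⊢
  | case4 a w b w' h _ ih =>
    rw [← List.singleton_append (x := a) (l := w), wordEval_append, ← ih, h,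
      ← List.singleton_append (x := a) (l := b :: w'), wordEval_append]

/-- The letters `0` and `1` as the generators of the free group of rank two. -/
def freeLetter (k : ℕ) : FreeGroup (Fin 2) := FreeGroup.of (if k = 0 then 0 else 1)

/-- Lists of six colours. -/
abbrev SixColors : Type := {l : List Color // l.length = 6}

/-- The permutation of `SixColors × FreeGroup (Fin 2)` by which `σᵢ` acts, twisted by the
cocycle. -/
def twistedMove (i : ℕ) : Equiv.Perm (SixColors × FreeGroup (Fin 2)) where
  toFun x := (⟨move i x.1.1, by simp [x.1.2]⟩, wordEval freeLetter (label i x.1.1) * x.2)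
  invFun x := (⟨moveInv i x.1.1, by simp [x.1.2]⟩,
    (wordEval freeLetter (label i (moveInv i x.1.1)))⁻¹ * x.2)
  left_inv x := by simp
  right_inv x := by simp

theorem wordEval_twistedMove (w : Word) (l : SixColors) (k : FreeGroup (Fin 2)) :
    wordEval twistedMove w (l, k) =
      (⟨wordAct w l.1, by simp [l.2]⟩, wordEval freeLetter (pathLabel w l.1) * k) := by
  induction w with
  | nil => simp [wordAct, pathLabel]
  | cons a w ih =>
    obtain ⟨i, _ | _⟩ := a
    · rw [wordEval_cons_false, Equiv.Perm.mul_apply, ih]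
      change (twistedMove i).symm _ = _
      simp [twistedMove, wordAct, pathLabel, mul_assoc]
    · rw [wordEval_cons_true, Equiv.Perm.mul_apply, ih]
      simp [twistedMove, wordAct, pathLabel, mul_assoc]

/-- The cocycle is trivial at the braid relators. -/
theorem pathLabel_relatorWords : ((allColorLists 6).all fun l => (relatorWords 6).all fun r =>
    (freeReduce (pathLabel r l)).isEmpty) = true := by
  decide +kernel

theorem mem_relatorWords_braid {n i : ℕ} (hi : 1 ≤ i) (hn : i + 1 < n) :
    [(i, true), (i + 1, true), (i, true), (i + 1, false), (i, false), (i + 1, false)] ∈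
      relatorWords n :=
  List.mem_flatMap.2 ⟨i, List.mem_range'_1.2 (by omega),
    List.mem_map.2 ⟨i + 1, List.mem_range'_1.2 (by omega), by simp⟩⟩

theorem mem_relatorWords_comm {n i j : ℕ} (hi : 1 ≤ i) (hij : i + 2 ≤ j) (hn : j < n) :
    [(i, true), (j, true), (i, false), (j, false)] ∈ relatorWords n :=
  List.mem_flatMap.2 ⟨i, List.mem_range'_1.2 (by omega),
    List.mem_map.2 ⟨j, List.mem_range'_1.2 (by omega), by
      rw [if_neg (by omega)]⟩⟩

theorem wordEval_twistedMove_relator {r : Word} (hr : r ∈ relatorWords 6)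
    (h : ∀ l : List Color, l.length = 6 → wordAct r l = l) :
    wordEval twistedMove r = 1 := by
  ext1 ⟨l, k⟩
  have h1 := List.all_eq_true.1 (List.all_eq_true.1 pathLabel_relatorWords l.1
    (mem_allColorLists l.2)) r hr
  rw [List.isEmpty_iff] at h1
  rw [wordEval_twistedMove, ← wordEval_freeReduce, h1]
  simp [h l.1 l.2]

theorem twistedMove_rels {n : ℕ} (hn : n ≤ 6) (r : FreeGroup (Fin (n - 1)))
    (hr : r ∈ braidRels n) :
    FreeGroup.lift (fun i : Fin (n - 1) => twistedMove (i + 1)) r = 1 := by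
  rcases hr with ⟨i, j, hij, rfl⟩ | ⟨i, j, hij, rfl⟩
  · have h := wordEval_twistedMove_relator
      (mem_relatorWords_braid (n := 6) (i := i + 1) (by omega) (by omega)) fun l hl => by
        simp only [wordAct]
        rw [move_braid _ _ (by simp; omega) (by omega)]
        simp
    simp only [map_mul, map_inv, FreeGroup.lift_apply_of, ← hij]
    simpa [mul_assoc] using h
  · have h := wordEval_twistedMove_relator
      (mem_relatorWords_comm (n := 6) (i := i + 1) (j := j + 1) (by omega) (by omega) (by omega))
      fun l hl => by
        simp only [wordAct]
        rw [move_comm _ _ _ (by omega)]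
        simp
    simp only [map_mul, map_inv, FreeGroup.lift_apply_of]
    simpa [mul_assoc] using h

/-- The action of `Brₙ`, `n ≤ 6`, on `SixColors × FreeGroup (Fin 2)` given by the cocycle. -/
def twistedAction {n : ℕ} (hn : n ≤ 6) :
    BraidGroup n →* Equiv.Perm (SixColors × FreeGroup (Fin 2)) :=
  PresentedGroup.toGroup (f := fun i : Fin (n - 1) => twistedMove (i + 1)) (twistedMove_rels hn)

theorem twistedAction_sigma {n i : ℕ} (hn : n ≤ 6) (h1 : 1 ≤ i) (hi : i < n) :
    twistedAction hn (sigma n i) = twistedMove i := by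
  obtain ⟨i, rfl⟩ : ∃ k, i = k + 1 := ⟨i - 1, by omega⟩
  rw [sigma, dif_pos ⟨h1, hi⟩, twistedAction]
  erw [PresentedGroup.toGroup.of]
  rfl

theorem twistedAction_wordEval {n : ℕ} (hn : n ≤ 6) {w : Word}
    (hw : ∀ a ∈ w, 1 ≤ a.1 ∧ a.1 < n) (l : SixColors) (k : FreeGroup (Fin 2)) :
    twistedAction hn (wordEval (sigma n) w) (l, k) =
      (⟨wordAct w l.1, by simp [l.2]⟩, wordEval freeLetter (pathLabel w l.1) * k) := by
  rw [← wordEval_twistedMove, map_wordEval]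
  congr 1
  induction w with
  | nil => rfl
  | cons a w ih =>
    have ha := hw a (by simp)
    obtain ⟨i, _ | _⟩ := a <;>
      simp [twistedAction_sigma hn ha.1 ha.2, ih fun b hb => hw b (by simp [hb])]

/-! ### The conjugates of the generators of `Eₙ` -/

/-- For the generator `x = e_{ij}` and `y = τ₁ x τ₁⁻¹` (if the sign is `true`) or `y = τ₁⁻¹ x τ₁` (if
it is `false`), a word `W` in the generators of `Eₙ` and a pair `(k, l)` with `W y W⁻¹ = e_{kl}`. -/
def tauOneConj : Bool → ℕ → ℕ → List (ℕ × ℕ × Bool) × ℕ × ℕ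
  | true, 1, 2 => ([(2, 4, false)], 4, 5)
  | true, 1, 3 => ([(1, 2, false), (2, 4, true), (4, 5, true), (2, 4, false)], 1, 3)
  | true, 1, 4 => ([(2, 4, false), (2, 4, false)], 4, 5)
  | true, 1, 5 => ([(2, 5, true), (4, 5, true), (2, 4, true), (4, 5, true)], 1, 5)
  | true, 1, 6 => ([(2, 4, false), (2, 6, false)], 4, 5)
  | true, 2, 3 =>
    ([(2, 4, false), (1, 2, true), (1, 3, true), (2, 4, true), (4, 5, true), (2, 4, false)], 4, 5)
  | true, 2, 4 => ([], 2, 4)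
  | true, 2, 5 => ([(1, 3, false), (1, 2, false), (3, 5, false), (4, 5, true), (2, 4, true)], 1, 2)
  | true, 2, 6 => ([], 2, 6)
  | true, 3, 4 => ([(2, 4, false), (1, 2, true), (1, 3, true), (2, 4, true), (4, 5, true)], 4, 5)
  | true, 3, 5 =>
    ([(4, 5, true), (2, 4, false), (1, 2, true), (1, 3, true), (2, 4, true), (4, 5, true)], 3, 5)
  | true, 3, 6 =>
    ([(2, 4, false), (1, 2, true), (1, 3, true), (2, 4, true), (4, 5, true), (4, 6, false)], 4, 5)
  | true, 4, 5 => ([(1, 3, false), (1, 2, false), (3, 5, false), (4, 5, true)], 1, 2)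
  | true, 4, 6 => ([], 4, 6)
  | true, 5, 6 => ([(1, 3, false), (1, 2, false), (3, 5, false), (4, 5, true), (4, 6, true)], 1, 2)
  | false, 1, 2 => ([(3, 5, false), (3, 4, false), (1, 3, true), (1, 2, false)], 3, 4)
  | false, 1, 3 =>
    ([(1, 2, false), (2, 4, true), (4, 5, false), (3, 5, false), (2, 4, false), (1, 2, false)], 1, 3)
  | false, 1, 4 =>
    ([(3, 5, false), (3, 4, false), (1, 3, true), (1, 2, false), (2, 4, false)], 3, 4)
  | false, 1, 5 => ([(1, 4, false), (1, 2, false), (2, 4, false), (1, 2, false)], 1, 5)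
  | false, 1, 6 =>
    ([(3, 5, false), (3, 4, false), (1, 3, true), (1, 2, false), (2, 6, false)], 3, 4)
  | false, 2, 3 =>
    ([(2, 4, true), (4, 5, false), (3, 5, false), (2, 4, false), (1, 2, false)], 1, 2)
  | false, 2, 4 => ([], 2, 4)
  | false, 2, 5 => ([(2, 4, true), (2, 4, true)], 1, 2)
  | false, 2, 6 => ([], 2, 6)
  | false, 3, 4 =>
    ([(2, 4, true), (4, 5, false), (3, 5, false), (2, 4, false), (1, 2, false), (2, 4, true)], 1, 2)
  | false, 3, 5 => ([(4, 5, true), (2, 4, false), (1, 2, false), (2, 4, true)], 3, 5)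
  | false, 3, 6 =>
    ([(2, 4, true), (4, 5, false), (3, 5, false), (2, 4, false), (1, 2, false), (2, 6, true)], 1, 2)
  | false, 4, 5 => ([(2, 4, true)], 1, 2)
  | false, 4, 6 => ([], 4, 6)
  | false, 5, 6 => ([(2, 4, true), (4, 6, true)], 1, 2)
  | _, _, _ => ([], 0, 0)

/-- The same for `τ₂`. For `i ≥ 2` the identities are those for `τ₁` on the last five strands. -/
def tauTwoConj : Bool → ℕ → ℕ → List (ℕ × ℕ × Bool) × ℕ × ℕ
  | true, 1, 2 => ([(3, 5, false), (1, 3, false)], 5, 6)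
  | true, 1, 3 => ([], 1, 3)
  | true, 1, 4 =>
    ([(3, 5, false), (2, 3, true), (2, 4, true), (3, 5, true), (5, 6, true), (1, 5, false)], 5, 6)
  | true, 1, 5 => ([], 1, 5)
  | true, 1, 6 => ([(2, 4, false), (2, 3, false), (4, 6, false), (5, 6, true), (1, 5, true)], 2, 3)
  | false, 1, 2 =>
    ([(4, 6, false), (4, 5, false), (2, 4, true), (2, 3, false), (1, 3, false)], 4, 5)
  | false, 1, 3 => ([], 1, 3)
  | false, 1, 4 =>
    ([(3, 5, true), (5, 6, false), (4, 6, false), (3, 5, false), (2, 3, false), (1, 3, true)], 2, 3)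
  | false, 1, 5 => ([], 1, 5)
  | false, 1, 6 => ([(3, 5, true), (1, 5, true)], 2, 3)
  | b, i, j =>
    let c := tauOneConj b (i - 1) (j - 1)
    (c.1.map fun a => (a.1 + 1, a.2.1 + 1, a.2.2), c.2.1 + 1, c.2.2 + 1)

/-- `w` if the sign is `true`, and its inverse otherwise. -/
def signed (w : Word) (b : Bool) : Word := bif b then w else FreeGroup.invRev w

/-- The word in the `σᵢ` for a word in the `e_{ij}`. -/
def eExpand (W : List (ℕ × ℕ × Bool)) : Word := W.flatMap fun a => signed (eWord a.1 a.2.1) a.2.2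

/-- `e_{ij}` is among the generators of `Eₙ`. -/
def isEIndex (n i j : ℕ) : Bool := Nat.ble 1 i && Nat.blt i j && Nat.ble j n

/-- The test of the identity `W y W⁻¹ = e_{kl}` for `y = τ e_{ij} τ⁻¹` or `y = τ⁻¹ e_{ij} τ`. -/
def checkConj (n : ℕ) (τ : Word) (b : Bool) (i j : ℕ) (c : List (ℕ × ℕ × Bool) × ℕ × ℕ) : Bool :=
  c.1.all (fun a => isEIndex n a.1 a.2.1) && isEIndex n c.2.1 c.2.2 &&
    isTrivial n (eExpand c.1 ++ (signed τ b ++ eWord i j ++ signed τ (!b)) ++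
      FreeGroup.invRev (eExpand c.1) ++ FreeGroup.invRev (eWord c.2.1 c.2.2))

theorem wordEval_signed {G : Type*} [Group G] (f : ℕ → G) (w : Word) (b : Bool) :
    wordEval f (signed w b) = if b then wordEval f w else (wordEval f w)⁻¹ := by
  cases b <;> simp [signed]

theorem e_mem_E {n i j : ℕ} (h : isEIndex n i j = true) : e n i j ∈ E n := by
  simp only [isEIndex, Bool.and_eq_true, Nat.ble_eq, Nat.blt_eq] at h
  exact Subgroup.subset_closure ⟨i, j, h.1.1, h.1.2, h.2, rfl⟩

theorem wordEval_eExpand_mem {n : ℕ} {W : List (ℕ × ℕ × Bool)}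
    (h : W.all (fun a => isEIndex n a.1 a.2.1) = true) :
    wordEval (sigma n) (eExpand W) ∈ E n := by
  induction W with
  | nil => exact (E n).one_mem
  | cons a W ih =>
    rw [List.all_cons, Bool.and_eq_true] at h
    rw [eExpand, List.flatMap_cons, wordEval_append, wordEval_signed, wordEval_eWord]
    refine (E n).mul_mem ?_ (ih h.2)
    split
    exacts [e_mem_E h.1, (E n).inv_mem (e_mem_E h.1)]

theorem conj_e_mem_of_checkConj {n : ℕ} {τ : Word} {b : Bool} {i j : ℕ}
    {c : List (ℕ × ℕ × Bool) × ℕ × ℕ} (h : checkConj n τ b i j c = true) :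
    wordEval (sigma n) (signed τ b) * e n i j * wordEval (sigma n) (signed τ (!b)) ∈ E n := by
  simp only [checkConj, Bool.and_eq_true] at h
  obtain ⟨⟨h1, h2⟩, h3⟩ := h
  have h4 := wordEval_eq_one_of_isTrivial h3
  simp only [wordEval_append, wordEval_invRev, wordEval_eWord] at h4
  have hW := wordEval_eExpand_mem h1
  rw [mul_inv_eq_one] at h4
  have h5 := e_mem_E h2
  rw [← h4] at h5
  exact ((E n).mul_mem_cancel_left hW).1 (((E n).mul_mem_cancel_right ((E n).inv_mem hW)).1 h5)

/-- Conjugation by `τ` and by `τ⁻¹` maps `Eₙ` to itself, if it does so for the generators. -/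
theorem conj_mem_E {n : ℕ} {τ : Word} {c : Bool → ℕ → ℕ → List (ℕ × ℕ × Bool) × ℕ × ℕ}
    (h : ((List.range' 1 (n - 1)).all fun i => (List.range' (i + 1) (n - i)).all fun j =>
      checkConj n τ true i j (c true i j) && checkConj n τ false i j (c false i j)) = true)
    {g : BraidGroup n} (hg : g ∈ E n) :
    wordEval (sigma n) τ * g * (wordEval (sigma n) τ)⁻¹ ∈ E n ∧
      (wordEval (sigma n) τ)⁻¹ * g * wordEval (sigma n) τ ∈ E n := by
  have key : ∀ b, ∀ g ∈ E n,
      wordEval (sigma n) (signed τ b) * g * wordEval (sigma n) (signed τ (!b)) ∈ E n := by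
    intro b g hg
    have hinv : wordEval (sigma n) (signed τ (!b)) = (wordEval (sigma n) (signed τ b))⁻¹ := by
      cases b <;> simp [wordEval_signed]
    rw [hinv]
    suffices E n ≤ (E n).comap (MulAut.conj (wordEval (sigma n) (signed τ b))).toMonoidHom from
      this hg
    refine (Subgroup.closure_le _).2 ?_
    rintro _ ⟨i, j, h1, h2, h3, rfl⟩
    have := List.all_eq_true.1 (List.all_eq_true.1 h i (List.mem_range'_1.2 (by omega))) j
      (List.mem_range'_1.2 (by omega))
    rw [Bool.and_eq_true] at this
    have h4 : checkConj n τ b i j (c b i j) = true := by cases b <;> simp [this]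
    have h5 := conj_e_mem_of_checkConj h4
    rw [hinv] at h5
    exact h5
  have h1 := key true g hg
  have h2 := key false g hg
  simp only [wordEval_signed, Bool.not_true, Bool.not_false, if_true, Bool.false_eq_true,
    if_false] at h1 h2
  exact ⟨h1, h2⟩

theorem conj_tau₁_mem_E_five {g : BraidGroup 5} (hg : g ∈ E 5) :
    tau₁ 5 * g * (tau₁ 5)⁻¹ ∈ E 5 ∧ (tau₁ 5)⁻¹ * g * tau₁ 5 ∈ E 5 := by
  rw [← wordEval_tauWord_zero]
  exact conj_mem_E (c := tauOneConj) (by decide +kernel) hg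

theorem conj_tau₁_mem_E_six {g : BraidGroup 6} (hg : g ∈ E 6) :
    tau₁ 6 * g * (tau₁ 6)⁻¹ ∈ E 6 ∧ (tau₁ 6)⁻¹ * g * tau₁ 6 ∈ E 6 := by
  rw [← wordEval_tauWord_zero]
  exact conj_mem_E (c := tauOneConj) (by decide +kernel) hg

theorem conj_tau₂_mem_E_six {g : BraidGroup 6} (hg : g ∈ E 6) :
    tau₂ 6 * g * (tau₂ 6)⁻¹ ∈ E 6 ∧ (tau₂ 6)⁻¹ * g * tau₂ 6 ∈ E 6 := by
  rw [← wordEval_tauWord_one]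
  exact conj_mem_E (c := tauTwoConj) (by decide +kernel) hg

/-! ### The stabiliser as a semidirect product -/

/-- A criterion for a group `S`, generated by a subgroup `N` and elements `xᵢ` that normalise it,
to be the semidirect product of `N` and the free group on the `xᵢ`: in some action on a product
`X × K` with a group `K`, the subgroup `N` fixes a point `(x₀, 1)`, and `xᵢ` acts on `{x₀} × K` as
left multiplication by the `i`-th member of a free family in `K`. -/
theorem exists_free_complement {G ι X K : Type*} [Group G] [Group K] {S N : Subgroup G} {x : ι → G}
    (hN : N ≤ S) (hx : ∀ i, x i ∈ S) (hgen : S ≤ N ⊔ Subgroup.closure (Set.range x))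
    (hconj : ∀ i, ∀ g ∈ N, x i * g * (x i)⁻¹ ∈ N ∧ (x i)⁻¹ * g * x i ∈ N)
    (A : G →* Equiv.Perm (X × K)) (x₀ : X) (hA : ∀ g ∈ N, A g (x₀, 1) = (x₀, 1)) {a : ι → K}
    (ha : Function.Injective (FreeGroup.lift a))
    (hxA : ∀ i k, A (x i) (x₀, k) = (x₀, a i * k)) :
    ∃ F : Subgroup G, IsFreelyGeneratedBy F x ∧ IsInternalSemidirectProduct S N F := by
  have hlift : ∀ (w : FreeGroup ι) (k : K),
      A (FreeGroup.lift x w) (x₀, k) = (x₀, FreeGroup.lift a w * k) := by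
    intro w
    induction w using FreeGroup.induction_on with
    | C1 => simp
    | of i => simpa using hxA i
    | inv_of i _ =>
      intro k
      rw [map_inv, map_inv, map_inv, Equiv.Perm.inv_eq_iff_eq, FreeGroup.lift_apply_of,
        FreeGroup.lift_apply_of, hxA]
      simp
    | mul u v hu hv =>
      intro k
      rw [map_mul, map_mul, map_mul, Equiv.Perm.mul_apply, hv, hu, mul_assoc]
  have hF : Subgroup.closure (Set.range x) ≤ S :=
    (Subgroup.closure_le _).2 (Set.range_subset_iff.2 hx)
  have hnorm : S ≤ Subgroup.normalizer (N : Set G) := by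
    refine hgen.trans (sup_le Subgroup.le_normalizer ((Subgroup.closure_le _).2 ?_))
    rintro _ ⟨i, rfl⟩
    refine Subgroup.mem_normalizer_iff.2 fun h => ⟨fun hh => (hconj i h hh).1, fun hh => ?_⟩
    have := (hconj i _ hh).2
    simpa [mul_assoc] using this
  have hnormal : (N.subgroupOf S).Normal := (Subgroup.normal_subgroupOf_iff_le_normalizer hN).2 hnorm
  refine ⟨Subgroup.closure (Set.range x), ⟨rfl, ?_⟩, hN, hF, hnormal, ?_⟩
  · refine (injective_iff_map_eq_one _).2 fun w hw => ha ?_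
    have := hlift w 1
    rw [hw] at this
    simpa using (congrArg Prod.snd this).symm
  · refine Subgroup.isComplement'_of_disjoint_and_mul_eq_univ ?_ ?_
    · rw [Subgroup.disjoint_def]
      rintro ⟨g, hg⟩ h1 h2
      rw [Subgroup.mem_subgroupOf] at h1 h2
      rw [← FreeGroup.range_lift_eq_closure] at h2
      obtain ⟨w, rfl⟩ := h2
      have h3 := hA _ h1
      rw [hlift] at h3
      obtain rfl : w = 1 := ha (by simpa using congrArg Prod.snd h3)
      ext
      simp
    · rw [← Subgroup.normal_mul, ← Subgroup.subgroupOf_sup hN hF, Set.eq_univ_iff_forall]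
      exact fun g => hgen g.2

/-- A test that the letters of `w` are generators of `Brₙ` and that `w` fixes the alternating
list. -/
def isLoop (n : ℕ) (w : Word) : Bool :=
  w.all (fun a => Nat.ble 1 a.1 && Nat.blt a.1 n) &&
    Nat.beq (code (wordAct w (altColors n))) (code (altColors n))

theorem isLoop_spec {n : ℕ} {w : Word} (h : isLoop n w = true) :
    (∀ a ∈ w, 1 ≤ a.1 ∧ a.1 < n) ∧ wordAct w (altColors n) = altColors n := by
  rw [isLoop, Bool.and_eq_true, List.all_eq_true] at h
  refine ⟨fun a ha => by simpa using h.1 a ha,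
    code_injective (by simp) (Nat.eq_of_beq_eq_true h.2)⟩

theorem eWord_mem_eWords {n i j : ℕ} (h1 : 1 ≤ i) (h2 : i < j) (h3 : j ≤ n) :
    eWord i j ∈ eWords n :=
  List.mem_flatMap.2 ⟨i, List.mem_range'_1.2 (by omega),
    List.mem_map.2 ⟨j, List.mem_range'_1.2 (by omega), rfl⟩⟩

theorem wordEval_mem_E_of_mem_eWords {n : ℕ} {w : Word} (h : w ∈ eWords n) :
    wordEval (sigma n) w ∈ E n := by
  obtain ⟨i, hi, h⟩ := List.mem_flatMap.1 h
  obtain ⟨j, hj, rfl⟩ := List.mem_map.1 h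
  rw [List.mem_range'_1] at hi hj
  rw [wordEval_eWord]
  exact Subgroup.subset_closure ⟨i, j, by omega, by omega, by omega, rfl⟩

/-- If coset enumeration with the generators `e_{ij}` and `τs` of a subgroup contained in `H` ends
with a complete table, then all words that fix the alternating list represent elements of `H`. -/
theorem wordEval_mem_of_isComplete {n k : ℕ} {τs : List Word} {H : Subgroup (BraidGroup n)}
    (hE : E n ≤ H) (hτ : ∀ w ∈ τs, wordEval (sigma n) w ∈ H)
    (hrel : ((relatorWords n).all (isTrivial n)) = true)
    (hlt : ((relatorWords n ++ (eWords n ++ τs)).all fun w => w.all fun a => Nat.blt a.1 n) = true)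
    (hc : CosetTable.isComplete n (CosetTable.rounds n ((relatorWords n).flatMap splits)
      ((eWords n ++ τs).flatMap splits) k (CosetTable.init n)) = true)
    {w : Word} (hw : ∀ a ∈ w, 1 ≤ a.1 ∧ a.1 < n) (h : wordAct w (altColors n) = altColors n) :
    wordEval (sigma n) w ∈ H := by
  have hlt' : ∀ w ∈ relatorWords n ++ (eWords n ++ τs), ∀ A B g s, w = A ++ (g, s) :: B → g < n := by
    intro w hw A B g s e
    have := List.all_eq_true.1 (List.all_eq_true.1 hlt w hw) (g, s) (by simp [e])
    simpa using this
  refine (CosetTable.isSound_init.rounds ?_ ?_ k).wordEval_mem hc hw h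
  · intro r hr
    obtain ⟨v, hv, hr⟩ := List.mem_flatMap.1 hr
    have h1 := wordEval_eq_one_of_isTrivial (List.all_eq_true.1 hrel v hv)
    obtain ⟨A, B, ⟨rfl, e1, e2⟩ | ⟨rfl, e1, e2⟩⟩ := exists_of_mem_splits hr
    · refine ⟨hlt' _ (List.mem_append_left _ hv) _ _ _ _ rfl, ?_⟩
      rw [e1, e2, wordEval_invRev]
      rw [wordEval_append, wordEval_cons_true] at h1
      exact eq_inv_of_mul_eq_one_right h1
    · refine ⟨hlt' _ (List.mem_append_left _ hv) _ _ _ _ rfl, ?_⟩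
      rw [e1, e2, wordEval_invRev]
      rw [wordEval_append, wordEval_cons_false] at h1
      rw [inv_eq_of_mul_eq_one_right h1, mul_inv_cancel_left]
  · intro r hr
    obtain ⟨v, hv, hr⟩ := List.mem_flatMap.1 hr
    have h1 : wordEval (sigma n) v ∈ H := by
      rcases List.mem_append.1 hv with hv | hv
      exacts [hE (wordEval_mem_E_of_mem_eWords hv), hτ v hv]
    obtain ⟨A, B, ⟨rfl, e1, e2⟩ | ⟨rfl, e1, e2⟩⟩ := exists_of_mem_splits hr
    · refine ⟨hlt' _ (List.mem_append_right _ hv) _ _ _ _ rfl, ?_⟩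
      rw [e1, e2, wordEval_invRev, inv_inv]
      rwa [wordEval_append, wordEval_cons_true] at h1
    · refine ⟨hlt' _ (List.mem_append_right _ hv) _ _ _ _ rfl, ?_⟩
      rw [e1, e2, wordEval_invRev]
      rw [wordEval_append, wordEval_cons_false] at h1
      convert H.inv_mem h1 using 1
      group

/-- The alternating list of length six. -/
def baseColors : SixColors := ⟨altColors 6, by simp⟩

/-- A test that `w` fixes the alternating list of length six and that its label there has the free
reduction `v`. -/
def hasLabel (w v : Word) : Bool :=
  isLoop 6 w && decide (freeReduce (pathLabel w (altColors 6)) = v)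

theorem twistedAction_of_hasLabel {n : ℕ} (hn : n ≤ 6) {w v : Word}
    (hw : ∀ a ∈ w, 1 ≤ a.1 ∧ a.1 < n) (h : hasLabel w v = true) (k : FreeGroup (Fin 2)) :
    twistedAction hn (wordEval (sigma n) w) (baseColors, k) =
      (baseColors, wordEval freeLetter v * k) := by
  rw [hasLabel, Bool.and_eq_true, decide_eq_true_eq] at h
  rw [twistedAction_wordEval hn hw]
  refine Prod.ext (Subtype.ext (isLoop_spec h.1).2) ?_
  simp only [baseColors, ← h.2, wordEval_freeReduce]

theorem twistedAction_of_mem_E {n : ℕ} (hn : n ≤ 6)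
    (h : ((eWords n).all fun w => isLoop n w && hasLabel w []) = true) {g : BraidGroup n}
    (hg : g ∈ E n) : twistedAction hn g (baseColors, 1) = (baseColors, 1) := by
  suffices E n ≤ (MulAction.stabilizer (Equiv.Perm (SixColors × FreeGroup (Fin 2)))
      (baseColors, (1 : FreeGroup (Fin 2)))).comap (twistedAction hn) from this hg
  refine (Subgroup.closure_le _).2 ?_
  rintro _ ⟨i, j, h1, h2, h3, rfl⟩
  have h4 := List.all_eq_true.1 h _ (eWord_mem_eWords h1 h2 h3)
  rw [Bool.and_eq_true] at h4
  have := twistedAction_of_hasLabel hn (isLoop_spec h4.1).1 h4.2 1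
  rw [wordEval_eWord] at this
  simpa using this

section Stabilizer

variable {C : Type*} [Group C] {s t : C}

theorem E_le_hurwitzStabilizer (hs : s * s = 1) (ht : t * t = 1) (hst : s * t * s = t * s * t)
    (hne : s ≠ t) {n : ℕ} (h : ((eWords n).all fun w => isLoop n w && hasLabel w []) = true) :
    E n ≤ hurwitzStabilizer (alternating s t n) := by
  refine (Subgroup.closure_le _).2 ?_
  rintro _ ⟨i, j, h1, h2, h3, rfl⟩
  have h4 := List.all_eq_true.1 h _ (eWord_mem_eWords h1 h2 h3)
  rw [Bool.and_eq_true] at h4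
  have h5 := isLoop_spec h4.1
  rw [← wordEval_eWord]
  exact (wordEval_mem_hurwitzStabilizer hs ht hst hne h5.1).2 h5.2

/-- `E₅` stabilises the alternating list, and the cocycle is trivial on it. -/
theorem eWords_five : ((eWords 5).all fun w => isLoop 5 w && hasLabel w []) = true := by
  decide +kernel

/-- `E₆` stabilises the alternating list, and the cocycle is trivial on it. -/
theorem eWords_six : ((eWords 6).all fun w => isLoop 6 w && hasLabel w []) = true := by
  decide +kernel

/-- Coset enumeration for `⟨E₅, τ₁⟩` closes on the orbit of the alternating list, which has `80`
elements. -/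
theorem isComplete_five :
    CosetTable.isComplete 5 (CosetTable.rounds 5 ((relatorWords 5).flatMap splits)
      ((eWords 5 ++ [tauWord 0]).flatMap splits) 5 (CosetTable.init 5)) = true := by
  decide +kernel

/-- Coset enumeration for `⟨E₆, τ₁, τ₂⟩` closes on the orbit of the alternating list, which has `240`
elements. -/
theorem isComplete_six :
    CosetTable.isComplete 6 (CosetTable.rounds 6 ((relatorWords 6).flatMap splits)
      ((eWords 6 ++ [tauWord 0, tauWord 1]).flatMap splits) 5 (CosetTable.init 6)) = true := by
  decide +kernel

theorem hurwitzStabilizer_five (hs : s * s = 1) (ht : t * t = 1) (hst : s * t * s = t * s * t)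
    (hne : s ≠ t) : ∃ F : Subgroup (BraidGroup 5), IsFreelyGeneratedBy F ![tau₁ 5] ∧
      IsInternalSemidirectProduct (hurwitzStabilizer (alternating s t 5)) (E 5) F := by
  have hτ : isLoop 5 (tauWord 0) = true := by decide +kernel
  refine exists_free_complement (E_le_hurwitzStabilizer hs ht hst hne eWords_five) ?_ ?_ ?_
    (twistedAction (by omega)) baseColors (fun g => twistedAction_of_mem_E _ eWords_five)
    (a := fun _ : Fin 1 => FreeGroup.of (0 : Fin 2)) ?_ ?_
  · rw [Fin.forall_fin_one, Matrix.cons_val_zero, ← wordEval_tauWord_zero]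
    exact (wordEval_mem_hurwitzStabilizer hs ht hst hne (isLoop_spec hτ).1).2 (isLoop_spec hτ).2
  · intro b hb
    obtain ⟨w, hw, rfl⟩ := exists_wordEval_eq b
    rw [wordEval_mem_hurwitzStabilizer hs ht hst hne hw] at hb
    refine wordEval_mem_of_isComplete le_sup_left ?_ (by decide +kernel) (by decide +kernel)
      isComplete_five hw hb
    rw [List.forall_mem_singleton, wordEval_tauWord_zero]
    exact Subgroup.mem_sup_right (Subgroup.subset_closure ⟨0, rfl⟩)
  · rw [Fin.forall_fin_one]
    exact fun g => conj_tau₁_mem_E_five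
  · have : (fun _ : Fin 1 => FreeGroup.of (0 : Fin 2)) = FreeGroup.of ∘ fun _ => 0 := rfl
    rw [this, ← FreeGroup.map_eq_lift]
    exact FreeGroup.map_injective (Function.injective_of_subsingleton _)
  · rw [Fin.forall_fin_one, Matrix.cons_val_zero, ← wordEval_tauWord_zero]
    exact twistedAction_of_hasLabel (v := [(0, true)]) _ (isLoop_spec hτ).1 (by decide +kernel)

theorem hurwitzStabilizer_six (hs : s * s = 1) (ht : t * t = 1) (hst : s * t * s = t * s * t)
    (hne : s ≠ t) : ∃ F : Subgroup (BraidGroup 6), IsFreelyGeneratedBy F ![tau₁ 6, tau₂ 6] ∧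
      IsInternalSemidirectProduct (hurwitzStabilizer (alternating s t 6)) (E 6) F := by
  have hτ₁ : isLoop 6 (tauWord 0) = true := by decide +kernel
  have hτ₂ : isLoop 6 (tauWord 1) = true := by decide +kernel
  refine exists_free_complement (E_le_hurwitzStabilizer hs ht hst hne eWords_six) ?_ ?_ ?_
    (twistedAction le_rfl) baseColors (fun g => twistedAction_of_mem_E _ eWords_six)
    (a := FreeGroup.of) ?_ ?_
  · rw [Fin.forall_fin_two, Matrix.cons_val_zero, Matrix.cons_val_one, Matrix.cons_val_zero,
      ← wordEval_tauWord_zero, ← wordEval_tauWord_one]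
    exact ⟨(wordEval_mem_hurwitzStabilizer hs ht hst hne (isLoop_spec hτ₁).1).2 (isLoop_spec hτ₁).2,
      (wordEval_mem_hurwitzStabilizer hs ht hst hne (isLoop_spec hτ₂).1).2 (isLoop_spec hτ₂).2⟩
  · intro b hb
    obtain ⟨w, hw, rfl⟩ := exists_wordEval_eq b
    rw [wordEval_mem_hurwitzStabilizer hs ht hst hne hw] at hb
    refine wordEval_mem_of_isComplete le_sup_left ?_ (by decide +kernel) (by decide +kernel)
      isComplete_six hw hb
    rw [List.forall_mem_cons, List.forall_mem_singleton, wordEval_tauWord_zero,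
      wordEval_tauWord_one]
    exact ⟨Subgroup.mem_sup_right (Subgroup.subset_closure ⟨0, rfl⟩),
      Subgroup.mem_sup_right (Subgroup.subset_closure ⟨1, rfl⟩)⟩
  · rw [Fin.forall_fin_two]
    exact ⟨fun g => conj_tau₁_mem_E_six, fun g => conj_tau₂_mem_E_six⟩
  · rw [FreeGroup.lift_of_eq_id]
    exact Function.injective_id
  · rw [Fin.forall_fin_two, Matrix.cons_val_zero, Matrix.cons_val_one, Matrix.cons_val_zero,
      ← wordEval_tauWord_zero, ← wordEval_tauWord_one]
    exact ⟨twistedAction_of_hasLabel (v := [(0, true)]) _ (isLoop_spec hτ₁).1 (by decide +kernel),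
      twistedAction_of_hasLabel (v := [(1, true)]) _ (isLoop_spec hτ₂).1 (by decide +kernel)⟩

end Stabilizer

/-- The two simple reflections of `A₂` differ, because a homomorphism to `𝒮₃` separates them. -/
theorem simple_zero_ne_simple_one {C : Type*} [Group C]
    (cs : CoxeterSystem (CoxeterMatrix.A 2) C) : cs.simple 0 ≠ cs.simple 1 := by
  intro h
  let f : Fin 2 → Equiv.Perm (Fin 3) := ![Equiv.swap 0 1, Equiv.swap 1 2]
  have hf : (CoxeterMatrix.A 2).IsLiftable f := by
    unfold CoxeterMatrix.IsLiftable
    decide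
  have h1 := cs.lift_apply_simple hf 0
  rw [h, cs.lift_apply_simple hf 1] at h1
  exact absurd h1 (by decide)

end HurwitzBraid

theorem mainTheorem2 {C : Type*} [Group C] (cs : CoxeterSystem (CoxeterMatrix.A 2) C) :
    (∃ F : Subgroup (HurwitzBraid.BraidGroup 5),
      HurwitzBraid.IsFreelyGeneratedBy F ![HurwitzBraid.tau₁ 5] ∧
      HurwitzBraid.IsInternalSemidirectProduct
        (HurwitzBraid.hurwitzStabilizer
          (HurwitzBraid.alternating (cs.simple 0) (cs.simple 1) 5))
        (HurwitzBraid.E 5) F) ∧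
    (∃ F : Subgroup (HurwitzBraid.BraidGroup 6),
      HurwitzBraid.IsFreelyGeneratedBy F ![HurwitzBraid.tau₁ 6, HurwitzBraid.tau₂ 6] ∧
      HurwitzBraid.IsInternalSemidirectProduct
        (HurwitzBraid.hurwitzStabilizer
          (HurwitzBraid.alternating (cs.simple 0) (cs.simple 1) 6))
        (HurwitzBraid.E 6) F) := by
  have hs := cs.simple_mul_simple_self 0
  have ht := cs.simple_mul_simple_self 1
  have hst : cs.simple 0 * cs.simple 1 * cs.simple 0 =
      cs.simple 1 * cs.simple 0 * cs.simple 1 := by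
    have h : (cs.simple 0 * cs.simple 1) ^ 3 = 1 := cs.simple_mul_simple_pow 0 1
    have h' : cs.simple 0 * cs.simple 1 * cs.simple 0 *
        (cs.simple 1 * cs.simple 0 * cs.simple 1) = 1 := by
      rw [← h]; simp only [pow_succ, pow_zero, one_mul, mul_assoc]
    rw [eq_inv_of_mul_eq_one_left h']
    simp [mul_assoc]
  have hne := HurwitzBraid.simple_zero_ne_simple_one cs
  exact ⟨HurwitzBraid.hurwitzStabilizer_five hs ht hst hne,
    HurwitzBraid.hurwitzStabilizer_six hs ht hst hne⟩
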